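/- Let $N,m\in\mathbb N$, $N\ge 1$, $1<p<\infty$. If $p<N$ put $p^*:=\frac{pN}{N-p}$. Let $l_1,\dots,l_m$ be real numbers with $0<l_i<\frac{p^2}{N}$; if $p\ge N$, let $p^*\in(p,\infty)$ be any exponent with $p^*\ge p+\max_i l_i$. Let $F:\mathbb R_+\times\mathbb R^m\to\mathbb R$ be a Carathéodory function, i.e. there is a null set $\Gamma\subset\mathbb R_+$ such that $F(\cdot,s)$ is measurable on $\mathbb R_+\setminus\Gamma$ for every $s\in\mathbb R^m$ and $F(r,\cdot)$ is continuous for every $r\in\mathbb R_+\setminus\Gamma$. Let $W^{1,p}_{\rm rad}(\mathbb R^N)$ denote the subspace of radially symmetric functions (about the origin) in $W^{1,p}(\mathbb R^N)$. A map defined on a subset $A$ of $W^{1,p}(\mathbb R^N)^m$ is called compact if it maps bounded subsets of $A$ to relatively compact sets. (a) Suppose that * (F1) there is $K>0$ such that $|F(r,s)|\le K\big(|s|^p+\sum_{i=1}^m|s_i|^{l_i+p}\big)$ for a.e. $r\ge0$ and every $s\in\mathbb R^m$; * (F2) for every $\varepsilon>0$ there exist $R_0>0$ and $s_0>0$ such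 that $|F(r,s)|\le\varepsilon|s|^p$ for a.e. $r\ge R_0$ and every $s\in\mathbb R^m$ with $|s_1|,\dots,|s_m|<s_0$. Then $U\mapsto F(|\cdot|,U)$ is a well-defined continuous map $(L^p\cap L^{p^*})(\mathbb R^N)^m\to L^1(\mathbb R^N)$ and, if $N\ge2$, a well-defined compact map $W^{1,p}_{\rm rad}(\mathbb R^N)^m\to L^1(\mathbb R^N)$. (b) Suppose only that * (F1$_+$) there is $K>0$ such that $0\le F(r,s)\le K\big(|s|^p+\sum_{i=1}^m s_i^{l_i+p}\big)$ for a.e. $r\ge0$ and every $s\in[0,\infty)^m$; * (F2$_+$) for every $\varepsilon>0$ there exist $R_0>0$ and $s_0>0$ such that $F(r,s)\le\varepsilon|s|^p$ for a.e. $r\ge R_0$ and every $s\in[0,s_0)^m$. Then the conclusions of (a) hold on nonnegative functions: $U\mapsto F(|\cdot|,U)$ is a well-defined continuous map from $\{U\in (L^p\cap L^{p^*})(\mathbb R^N)^m: u_i\ge0 \text{ a.e. for all } i\}$ to $L^1(\mathbb R^N)$ and, if $N\ge 2$, a well-defined compact map from $\{U\in W^{1,p}_{\rm rad}(\mathbb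 R^N)^m: u_i\ge0\text{ a.e. for all } i\}$ to $L^1(\mathbb R^N)$. -/

import Mathlib

open MeasureTheory Set
open scoped ENNReal ContDiff

/-- `ℝⁿ` with the Euclidean norm. -/
abbrev Euc (n : ℕ) : Type := EuclideanSpace ℝ (Fin n)

instance fact_one_le_ofReal {p : ℝ} [h : Fact (1 < p)] : Fact (1 ≤ ENNReal.ofReal p) :=
  ⟨by simpa using h.out.le⟩

/-! ### Function spaces -/

/-- The space `(L^p ∩ L^q)(ℝᴺ)`: a function of both classes is recorded as the pair of its
`L^p` class and its `L^q` class.  The norm inherited from the product is the maximum of the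
two norms, which is equivalent to their sum. -/
noncomputable def LpInter (N : ℕ) (p q : ℝ) [Fact (1 < p)] [Fact (1 < q)] :
    Submodule ℝ (Lp ℝ (ENNReal.ofReal p) (volume : Measure (Euc N)) ×
      Lp ℝ (ENNReal.ofReal q) (volume : Measure (Euc N))) where
  carrier := {u | (u.1 : Euc N → ℝ) =ᵐ[volume] (u.2 : Euc N → ℝ)}
  zero_mem' := (Lp.coeFn_zero ℝ _ _).trans (Lp.coeFn_zero ℝ _ _).symm
  add_mem' := fun {a b} ha hb =>
    (Lp.coeFn_add a.1 b.1).trans ((Filter.EventuallyEq.add (show (a.1 : Euc N → ℝ) =ᵐ[volume] (a.2 : Euc N → ℝ) from ha) hb).trans (Lp.coeFn_add a.2 b.2).symm)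
  smul_mem' := fun c a ha =>
    (Lp.coeFn_smul c a.1).trans ((Filter.EventuallyEq.const_smul
      (show (a.1 : Euc N → ℝ) =ᵐ[volume] (a.2 : Euc N → ℝ) from ha) c).trans (Lp.coeFn_smul c a.2).symm)

/-- A representative of an element of `L^p ∩ L^q`. -/
noncomputable def LpInter.rep {N : ℕ} {p q : ℝ} [Fact (1 < p)] [Fact (1 < q)]
    (u : LpInter N p q) : Euc N → ℝ :=
  (u.1.1 : Euc N → ℝ)

/-- `v` is the `j`-th weak partial derivative of `u` on `ℝᴺ`. It is used for `u` and `v` in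
some `L^p`, for which both integrands are integrable. -/
def IsWeakPartialDeriv {N : ℕ} (j : Fin N) (u v : Euc N → ℝ) : Prop :=
  ∀ φ : Euc N → ℝ, ContDiff ℝ ∞ φ → HasCompactSupport φ →
    ∫ x, u x * fderiv ℝ φ x (EuclideanSpace.single j 1) = - ∫ x, v x * φ x

theorem integrable_Lp_mul_test {N : ℕ} {p : ℝ} [Fact (1 < p)]
    (u : Lp ℝ (ENNReal.ofReal p) (volume : Measure (Euc N))) {g : Euc N → ℝ}
    (hg : Continuous g) (h'g : HasCompactSupport g) :
    Integrable (fun x => u x * g x) volume :=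
  ((Lp.memLp u).locallyIntegrable
    (fact_one_le_ofReal (p := p)).out).integrable_smul_right_of_hasCompactSupport hg h'g

theorem test_fderiv {N : ℕ} (j : Fin N) {φ : Euc N → ℝ} (h : ContDiff ℝ ∞ φ)
    (h' : HasCompactSupport φ) :
    Continuous (fun x => fderiv ℝ φ x (EuclideanSpace.single j 1)) ∧
      HasCompactSupport (fun x => fderiv ℝ φ x (EuclideanSpace.single j 1)) :=
  ⟨(h.continuous_fderiv (by simp)).clm_apply continuous_const, h'.fderiv_apply ℝ _⟩

/-- The Sobolev space `W^{1,p}(ℝᴺ)`: a function `u` is recorded together with its weak gradient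
`(∂₁u, …, ∂_N u)`.  The norm inherited from the product is
`max (‖u‖_p, ‖∂₁u‖_p, …, ‖∂_N u‖_p)`, which is equivalent to the usual one. -/
noncomputable def SobolevW1 (N : ℕ) (p : ℝ) [Fact (1 < p)] :
    Submodule ℝ (Lp ℝ (ENNReal.ofReal p) (volume : Measure (Euc N)) ×
      (Fin N → Lp ℝ (ENNReal.ofReal p) (volume : Measure (Euc N)))) where
  carrier := {u | ∀ j, IsWeakPartialDeriv j (u.1 : Euc N → ℝ) (u.2 j : Euc N → ℝ)}
  zero_mem' := by
    intro j φ hφ hc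
    have e1 : (fun x => (0 : Lp ℝ (ENNReal.ofReal p) (volume : Measure (Euc N))) x *
        fderiv ℝ φ x (EuclideanSpace.single j 1)) =ᵐ[volume] fun _ => (0 : ℝ) := by
      filter_upwards [Lp.coeFn_zero ℝ (ENNReal.ofReal p) (volume : Measure (Euc N))] with x hx
      simp
    have e2 : (fun x => (0 : Lp ℝ (ENNReal.ofReal p) (volume : Measure (Euc N))) x * φ x)
        =ᵐ[volume] fun _ => (0 : ℝ) := by
      filter_upwards [Lp.coeFn_zero ℝ (ENNReal.ofReal p) (volume : Measure (Euc N))] with x hx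
      simp
    have := integral_congr_ae e1
    have := integral_congr_ae e2
    simp_all
  add_mem' := by
    intro a b ha hb j φ hφ hc
    obtain ⟨d1, d2⟩ := test_fderiv j hφ hc
    have e1 : (fun x => (a + b).1 x * fderiv ℝ φ x (EuclideanSpace.single j 1)) =ᵐ[volume]
        fun x => a.1 x * fderiv ℝ φ x (EuclideanSpace.single j 1) +
          b.1 x * fderiv ℝ φ x (EuclideanSpace.single j 1) := by
      filter_upwards [Lp.coeFn_add a.1 b.1] with x hx
      simp only [Prod.fst_add, hx, Pi.add_apply, add_mul]
    have e2 : (fun x => (a + b).2 j x * φ x) =ᵐ[volume]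
        fun x => a.2 j x * φ x + b.2 j x * φ x := by
      filter_upwards [Lp.coeFn_add (a.2 j) (b.2 j)] with x hx
      simp only [Prod.snd_add, Pi.add_apply, hx, add_mul]
    rw [integral_congr_ae e1, integral_congr_ae e2,
      integral_add (integrable_Lp_mul_test a.1 d1 d2) (integrable_Lp_mul_test b.1 d1 d2),
      integral_add (integrable_Lp_mul_test (a.2 j) hφ.continuous hc)
        (integrable_Lp_mul_test (b.2 j) hφ.continuous hc),
      ha j φ hφ hc, hb j φ hφ hc]
    ring
  smul_mem' := by
    intro c a ha j φ hφ hc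
    have e1 : (fun x => (c • a).1 x * fderiv ℝ φ x (EuclideanSpace.single j 1)) =ᵐ[volume]
        fun x => c * (a.1 x * fderiv ℝ φ x (EuclideanSpace.single j 1)) := by
      filter_upwards [Lp.coeFn_smul c a.1] with x hx
      simp only [Prod.smul_fst, hx, Pi.smul_apply, smul_eq_mul, mul_assoc]
    have e2 : (fun x => (c • a).2 j x * φ x) =ᵐ[volume]
        fun x => c * (a.2 j x * φ x) := by
      filter_upwards [Lp.coeFn_smul c (a.2 j)] with x hx
      simp only [Prod.smul_snd, hx, Pi.smul_apply, smul_eq_mul, mul_assoc]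
    rw [integral_congr_ae e1, integral_congr_ae e2, integral_const_mul, integral_const_mul,
      ha j φ hφ hc]
    ring

/-- A representative of an element of `W^{1,p}`. -/
noncomputable def SobolevW1.rep {N : ℕ} {p : ℝ} [Fact (1 < p)]
    (u : SobolevW1 N p) : Euc N → ℝ :=
  (u.1.1 : Euc N → ℝ)

/-- `u` is (almost everywhere equal to) a function of `|x|`. -/
def IsRadial {N : ℕ} (u : Euc N → ℝ) : Prop :=
  ∃ g : ℝ → ℝ, u =ᵐ[volume] fun x => g ‖x‖

/-- The space `(W^{1,p}_rad)^m` of all `m`-tuples of radially symmetric Sobolev functions, as a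
subset of `(W^{1,p})^m`. -/
def radialTuples (N m : ℕ) (p : ℝ) [Fact (1 < p)] : Set (Fin m → SobolevW1 N p) :=
  {U | ∀ i, IsRadial (SobolevW1.rep (U i))}

/-! ### The nonlinearity

`F r s` is used only for `r ≥ 0`; `Ici 0` carries the one-dimensional Lebesgue measure. -/

/-- `F : ℝ₊ × ℝᵐ → ℝ` is a Carathéodory function: off a null set `Γ` of radii, `F(·,s)` is
(Lebesgue) measurable for every `s` and `F(r,·)` is continuous for every `r`. -/
def IsCaratheodory {m : ℕ} (F : ℝ → Euc m → ℝ) : Prop :=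
  ∃ Γ : Set ℝ, volume Γ = 0 ∧
    (∀ s, AEMeasurable (fun r => F r s) (volume.restrict (Ici 0 \ Γ))) ∧
    ∀ r ∈ Ici 0 \ Γ, Continuous (F r)

/-- Growth condition on the closed positive orthant:
`0 ≤ F(r,s) ≤ K (|s|^p + ∑ sᵢ^(lᵢ+p))` for almost every `r ≥ 0` and all `s` with `sᵢ ≥ 0`. -/
def GrowthNonneg {m : ℕ} (F : ℝ → Euc m → ℝ) (p : ℝ) (l : Fin m → ℝ) : Prop :=
  ∃ K : ℝ, 0 < K ∧ ∀ᵐ r ∂(volume.restrict (Ici (0 : ℝ))), ∀ s : Euc m, (∀ i, 0 ≤ s i) →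
    0 ≤ F r s ∧ F r s ≤ K * (‖s‖ ^ p + ∑ i, s i ^ (l i + p))

/-- Decay condition on the closed positive orthant: for every `ε > 0` there are `R₀, s₀ > 0` with
`F(r,s) ≤ ε |s|^p` for almost every `r ≥ R₀` and all `s` with `0 ≤ sᵢ < s₀`. -/
def DecayNonneg {m : ℕ} (F : ℝ → Euc m → ℝ) (p : ℝ) : Prop :=
  ∀ ε : ℝ, 0 < ε → ∃ R₀ s₀ : ℝ, 0 < R₀ ∧ 0 < s₀ ∧
    ∀ᵐ r ∂(volume.restrict (Ici R₀)), ∀ s : Euc m, (∀ i, 0 ≤ s i ∧ s i < s₀) →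
      F r s ≤ ε * ‖s‖ ^ p

/-- Growth condition on all of `ℝᵐ`:
`|F(r,s)| ≤ K (|s|^p + ∑ |sᵢ|^(lᵢ+p))` for almost every `r ≥ 0` and all `s`. -/
def GrowthAbs {m : ℕ} (F : ℝ → Euc m → ℝ) (p : ℝ) (l : Fin m → ℝ) : Prop :=
  ∃ K : ℝ, 0 < K ∧ ∀ᵐ r ∂(volume.restrict (Ici (0 : ℝ))), ∀ s : Euc m,
    |F r s| ≤ K * (‖s‖ ^ p + ∑ i, |s i| ^ (l i + p))

/-- Decay condition on all of `ℝᵐ`: for every `ε > 0` there are `R₀, s₀ > 0` with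
`|F(r,s)| ≤ ε |s|^p` for almost every `r ≥ R₀` and all `s` with `|sᵢ| < s₀`. -/
def DecayAbs {m : ℕ} (F : ℝ → Euc m → ℝ) (p : ℝ) : Prop :=
  ∀ ε : ℝ, 0 < ε → ∃ R₀ s₀ : ℝ, 0 < R₀ ∧ 0 < s₀ ∧
    ∀ᵐ r ∂(volume.restrict (Ici R₀)), ∀ s : Euc m, (∀ i, |s i| < s₀) →
      |F r s| ≤ ε * ‖s‖ ^ p

/-! ### The Nemytskii operator -/

/-- The function `x ↦ F(|x|, U(x))`. -/
noncomputable def nemytskii {N m : ℕ} (F : ℝ → Euc m → ℝ) (U : Fin m → Euc N → ℝ) :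
    Euc N → ℝ :=
  fun x => F ‖x‖ (WithLp.toLp 2 fun i => U i x)

/-- `U ↦ F(|·|,U)` is a well-defined and continuous map from the subset `A` of
`(L^p ∩ L^q)(ℝᴺ)^m` to `L¹(ℝᴺ)`. -/
def NemytskiiContinuousOn {N m : ℕ} (F : ℝ → Euc m → ℝ) {p q : ℝ} [Fact (1 < p)] [Fact (1 < q)]
    (A : Set (Fin m → LpInter N p q)) : Prop :=
  ∃ h : ∀ U : A, MemLp (nemytskii F fun i => LpInter.rep (U.1 i)) 1 (volume : Measure (Euc N)),
    Continuous fun U : A => (h U).toLp _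

/-- `U ↦ F(|·|,U)` is a well-defined map from the subset `A` of `W^{1,p}(ℝᴺ)^m` to `L¹(ℝᴺ)`
which sends bounded subsets of `A` to relatively compact sets. -/
def NemytskiiCompactOn {N m : ℕ} (F : ℝ → Euc m → ℝ) {p : ℝ} [Fact (1 < p)]
    (A : Set (Fin m → SobolevW1 N p)) : Prop :=
  ∃ h : ∀ U : A, MemLp (nemytskii F fun i => SobolevW1.rep (U.1 i)) 1 (volume : Measure (Euc N)),
    ∀ B : Set A, Bornology.IsBounded B →
      IsCompact (closure ((fun U : A => (h U).toLp _) '' B))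

/-! Continuity is a dominated convergence argument with varying dominants. Since `p ≤ l i + p ≤ q`,
the growth condition bounds `|F(|x|,U)|` by a constant times `∑ (|u_i|^p + |u_i|^q)`. The integral
of this dominant is a sum of powers of norms, so it converges along any convergent sequence of
tuples. After extraction of an almost everywhere convergent subsequence,
`tendsto_eLpNorm_one_of_tendsto_dominating` gives convergence in `L¹`.

Compactness rests on a quantitative radial lemma, `exists_radial_representative`. Testing the weak
gradient of `u` with the fields `κ(|x|) x` shows that the spherical integral of `u` has the
spherical integral of the radial derivative as weak derivative on `(0, ∞)`. By du Bois-Reymond it is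
a primitive, and Hölder on annuli bounds its increments by `‖u‖ J(r,s)^(1/p')`, where `J(r,s) =
∫_r^s t^(-(N-1)/(p-1)) dt`, up to a constant. A radial function is its spherical integral divided by
the area of the sphere, so it inherits these bounds, together with a pointwise bound by `‖u‖
J(r,r+1)^(1/p')`.

Three consequences, uniform on bounded sets, finish the proof. Equicontinuity away from the origin
yields subsequences converging almost everywhere. Near the origin `|u| ≤ C |x|^(-a)` with `a (l_i +
p) < N`; for `p < N` and `a = (N-p)/p`, this follows from `l_i < p²/N` and the identity `a (p +
p²/N) = N - p²/N`. So `F(|x|,U)` has an integrable majorant on every ball. At infinity `u` tends to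
zero because `N ≥ 2`, so outside a large ball the decay condition makes the integral of `|F(|x|,U)|`
at most `ε` times a bounded quantity. Almost everywhere convergence, domination on a ball and
uniformly small tails give convergence in `L¹`.

Part (b) follows from part (a) applied to `F(r, |s_1|, …, |s_m|)`, which agrees with `F` on
nonnegative tuples. -/

set_option linter.unusedSectionVars false

/-! ### Polar coordinates and spherical integrals -/

section Polar

variable {E : Type*} [NormedAddCommGroup E] [NormedSpace ℝ E] [MeasurableSpace E] [BorelSpace E]
  [FiniteDimensional ℝ E]

/-- The measure on the real line with density `r ^ n` on `(0, ∞)`. -/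
noncomputable def radialMeasure (n : ℕ) : Measure ℝ :=
  (volume.restrict (Ioi (0 : ℝ))).withDensity fun r => ENNReal.ofReal (r ^ n)

theorem map_volumeIoiPow (n : ℕ) :
    (Measure.volumeIoiPow n).map (Subtype.val : Ioi (0 : ℝ) → ℝ) = radialMeasure n := by
  rw [Measure.volumeIoiPow, radialMeasure, ← map_comap_subtype_coe measurableSet_Ioi]
  ext s hs
  rw [Measure.map_apply measurable_subtype_coe hs, withDensity_apply _ hs,
    withDensity_apply _ (measurable_subtype_coe hs), setLIntegral_map hs (by fun_prop)
      measurable_subtype_coe]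

instance (n : ℕ) : SFinite (radialMeasure n) := by
  unfold radialMeasure; infer_instance

/-- Polar coordinates, as a map on the product of the unit sphere with the real line. -/
def polarMap (E : Type*) [NormedAddCommGroup E] [NormedSpace ℝ E] :
    Metric.sphere (0 : E) 1 × ℝ → E := fun z => z.2 • (z.1 : E)

/-- The polar homeomorphism lives on the punctured space and on a subtype of positive radii.
Composed with it, `polarMap` is the inclusion, and the origin is a null set, so both subtypes can be
dropped. -/
theorem measurePreserving_polarMap [Nontrivial E] (μ : Measure E) [μ.IsAddHaarMeasure] :
    MeasurePreserving (polarMap E)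
      (μ.toSphere.prod (radialMeasure (Module.finrank ℝ E - 1))) μ := by
  have hm : Measurable (polarMap E) := by unfold polarMap; fun_prop
  refine ⟨hm, ?_⟩
  have h1 : μ.toSphere.prod (radialMeasure (Module.finrank ℝ E - 1)) =
      (μ.toSphere.prod (Measure.volumeIoiPow (Module.finrank ℝ E - 1))).map
        (Prod.map id Subtype.val) := by
    rw [← Measure.map_prod_map _ _ measurable_id measurable_subtype_coe, Measure.map_id,
      map_volumeIoiPow]
  have h2 := (μ.measurePreserving_homeomorphUnitSphereProd).map_eq
  rw [h1, Measure.map_map hm (by fun_prop), ← h2,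
    Measure.map_map (hm.comp (by fun_prop)) (Homeomorph.measurable _)]
  have h3 : (polarMap E ∘ Prod.map id Subtype.val) ∘ (homeomorphUnitSphereProd E) =
      Subtype.val := by
    funext x
    have hx : ‖(x : E)‖ ≠ 0 := norm_ne_zero_iff.2 x.2
    simp [polarMap, smul_smul, hx]
  rw [h3, map_comap_subtype_coe (measurableSet_singleton _).compl, restrict_compl_singleton]

theorem ae_radialMeasure_iff {n : ℕ} {p : ℝ → Prop} :
    (∀ᵐ r ∂(radialMeasure n), p r) ↔ ∀ᵐ r ∂(volume.restrict (Ioi (0 : ℝ))), p r := by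
  rw [radialMeasure, ae_withDensity_iff (by fun_prop)]
  refine Filter.eventually_congr ?_
  filter_upwards [ae_restrict_mem measurableSet_Ioi] with r (hr : 0 < r)
  simp [pow_pos hr n]

theorem integral_radialMeasure {n : ℕ} (f : ℝ → ℝ) :
    ∫ r, f r ∂(radialMeasure n) = ∫ r in Ioi 0, r ^ n * f r := by
  rw [radialMeasure, integral_withDensity_eq_integral_toReal_smul (by fun_prop) (by simp)]
  refine setIntegral_congr_fun measurableSet_Ioi fun r (hr : 0 < r) => ?_
  simp [ENNReal.toReal_ofReal (pow_pos hr n).le]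

theorem integrable_radialMeasure_iff {n : ℕ} {f : ℝ → ℝ} :
    Integrable f (radialMeasure n) ↔ IntegrableOn (fun r => r ^ n * f r) (Ioi 0) := by
  rw [radialMeasure, integrable_withDensity_iff_integrable_smul' (by fun_prop) (by simp)]
  refine integrableOn_congr_fun (fun r (hr : 0 < r) => ?_) measurableSet_Ioi
  simp [ENNReal.toReal_ofReal (pow_pos hr n).le]

theorem norm_polarMap {z : Metric.sphere (0 : E) 1 × ℝ} (hz : 0 < z.2) :
    ‖polarMap E z‖ = z.2 := by
  simp [polarMap, norm_smul, abs_of_pos hz]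

variable (μ : Measure E) [μ.IsAddHaarMeasure]

theorem ae_snd_pos {n : ℕ} : ∀ᵐ z ∂(μ.toSphere.prod (radialMeasure n)), 0 < z.2 :=
  Measure.quasiMeasurePreserving_snd.ae (p := fun r => 0 < r)
    (ae_radialMeasure_iff.2 (ae_restrict_mem measurableSet_Ioi))

/-- In polar coordinates the norm is the second coordinate, whose law has a positive density on `(0,
∞)`. This transfers conditions valid for almost every radius to almost every point. -/
theorem quasiMeasurePreserving_norm [Nontrivial E] :
    Measure.QuasiMeasurePreserving (norm : E → ℝ) μ (volume.restrict (Ioi 0)) := by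
  refine ⟨measurable_norm, ?_⟩
  intro s hs
  have hP := measurePreserving_polarMap μ
  obtain ⟨t, hst, htm, ht⟩ := exists_measurable_superset_of_null hs
  refine measure_mono_null hst ?_
  rw [Measure.map_apply measurable_norm htm, ← hP.measure_preimage
    (measurable_norm htm).nullMeasurableSet, measure_eq_zero_iff_ae_notMem]
  have h1 : ∀ᵐ r ∂(radialMeasure (Module.finrank ℝ E - 1)), r ∉ t :=
    ae_radialMeasure_iff.2 (measure_eq_zero_iff_ae_notMem.1 ht)
  filter_upwards [Measure.quasiMeasurePreserving_snd.ae h1, ae_snd_pos μ] with z hz hz2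
  simpa [norm_polarMap hz2] using hz

/-- The integral of `w` over the sphere of radius `r` with respect to the
surface measure of the unit sphere. -/
noncomputable def sphereIntegral (w : E → ℝ) (r : ℝ) : ℝ :=
  ∫ σ, w (r • (σ : E)) ∂μ.toSphere

theorem abs_sphereIntegral_le (w : E → ℝ) (r : ℝ) :
    |sphereIntegral μ w r| ≤ sphereIntegral μ (fun x => |w x|) r :=
  abs_integral_le_integral_abs

theorem sphereIntegral_mul_radial (w : E → ℝ) (ψ : ℝ → ℝ) {r : ℝ} (hr : 0 < r) :
    sphereIntegral μ (fun x => w x * ψ ‖x‖) r = sphereIntegral μ w r * ψ r := by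
  simp only [sphereIntegral]
  rw [← integral_mul_const]
  congr 1
  funext σ
  simp [norm_smul, abs_of_pos hr]

theorem integrableOn_sphereIntegral [Nontrivial E] {w : E → ℝ} (hw : Integrable w μ) :
    IntegrableOn (fun r => r ^ (Module.finrank ℝ E - 1) * sphereIntegral μ w r) (Ioi 0) := by
  rw [← integrable_radialMeasure_iff]
  exact ((measurePreserving_polarMap μ).integrable_comp_of_integrable hw).integral_prod_right

theorem integral_eq_integral_sphereIntegral [Nontrivial E] {w : E → ℝ} (hw : Integrable w μ) :
    ∫ x, w x ∂μ = ∫ r in Ioi 0, r ^ (Module.finrank ℝ E - 1) * sphereIntegral μ w r := by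
  have hP := measurePreserving_polarMap μ
  rw [← integral_radialMeasure]
  conv_lhs => rw [← hP.map_eq]
  rw [integral_map hP.measurable.aemeasurable (by rw [hP.map_eq]; exact hw.1),
    integral_prod_symm]
  · rfl
  · exact hP.integrable_comp_of_integrable hw

theorem integrableOn_sphereIntegral_mul [Nontrivial E] {w : E → ℝ} {ψ : ℝ → ℝ}
    (hw : Integrable (fun x => w x * ψ ‖x‖) μ) :
    IntegrableOn (fun r => r ^ (Module.finrank ℝ E - 1) * (sphereIntegral μ w r * ψ r))
      (Ioi 0) :=
  (integrableOn_congr_fun (fun r hr => by rw [sphereIntegral_mul_radial μ w ψ hr])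
    measurableSet_Ioi).1 (integrableOn_sphereIntegral μ hw)

theorem integral_mul_radial [Nontrivial E] {w : E → ℝ} {ψ : ℝ → ℝ}
    (hw : Integrable (fun x => w x * ψ ‖x‖) μ) :
    ∫ x, w x * ψ ‖x‖ ∂μ =
      ∫ r in Ioi 0, r ^ (Module.finrank ℝ E - 1) * (sphereIntegral μ w r * ψ r) := by
  rw [integral_eq_integral_sphereIntegral μ hw]
  exact setIntegral_congr_fun measurableSet_Ioi fun r hr => by
    simp only [sphereIntegral_mul_radial μ w ψ hr]

/-- The `L¹` norm of the spherical integrals is controlled on every set of positive radii. -/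
theorem integrableOn_and_integral_abs_sphereIntegral_le [Nontrivial E] {w : E → ℝ} {A : Set ℝ}
    (hA : MeasurableSet A) (hA0 : A ⊆ Ioi 0) {q : ℕ} (hq : q = Module.finrank ℝ E - 1)
    (hw : Integrable (fun x => w x * A.indicator (fun r => (r ^ q)⁻¹) ‖x‖) μ) :
    IntegrableOn (sphereIntegral μ w) A ∧
      ∫ r in A, |sphereIntegral μ w r| ≤
        ∫ x, |w x * A.indicator (fun r => (r ^ q)⁻¹) ‖x‖| ∂μ := by
  subst hq
  set q := Module.finrank ℝ E - 1
  -- The weight `r^(-q)` cancels the polar Jacobian `r^q`, leaving the bare spherical integral on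
  -- `A`.
  have key : ∀ v : E → ℝ, EqOn (fun r => r ^ q * (sphereIntegral μ v r *
      A.indicator (fun r => (r ^ q)⁻¹) r)) (A.indicator (sphereIntegral μ v)) (Ioi 0) := by
    intro v r (hr : 0 < r)
    by_cases h : r ∈ A
    · simp only [indicator_of_mem h]
      field_simp
    · simp [indicator_of_notMem h]
  have h1 : ∀ v : E → ℝ, Integrable (fun x => v x * A.indicator (fun r => (r ^ q)⁻¹) ‖x‖) μ →
      IntegrableOn (sphereIntegral μ v) A ∧ ∫ r in A, sphereIntegral μ v r =
        ∫ x, v x * A.indicator (fun r => (r ^ q)⁻¹) ‖x‖ ∂μ := by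
    intro v hv
    constructor
    · have := (integrableOn_congr_fun (key v) measurableSet_Ioi).1
        (integrableOn_sphereIntegral_mul μ hv)
      rw [IntegrableOn, integrable_indicator_iff hA, IntegrableOn,
        Measure.restrict_restrict hA, inter_eq_left.2 hA0] at this
      exact this
    · rw [integral_mul_radial μ hv, setIntegral_congr_fun measurableSet_Ioi (key v),
        setIntegral_indicator hA, inter_eq_right.2 hA0]
  have habs : ∀ x, |w x * A.indicator (fun r => (r ^ q)⁻¹) ‖x‖| =
      |w x| * A.indicator (fun r => (r ^ q)⁻¹) ‖x‖ := by
    intro x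
    rw [abs_mul, abs_of_nonneg (indicator_nonneg (fun r hr => ?_) _)]
    have : 0 < r := hA0 hr
    positivity
  obtain ⟨i2, e2⟩ := h1 (fun x => |w x|) (by simpa only [habs] using hw.abs)
  refine ⟨(h1 w hw).1, ?_⟩
  simp only [habs]
  rw [← e2]
  exact integral_mono (h1 w hw).1.abs i2 fun r => abs_sphereIntegral_le μ w r

end Polar

/-! ### Weak derivatives and primitives on the half-line -/

section DuBoisReymond

/-- The requirement `a < 1 < b` puts the base point `1` of the primitives used below inside the
interval. -/
theorem tsupport_subset_Icc_of_pos {η : ℝ → ℝ} (hc : HasCompactSupport η)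
    (hs : tsupport η ⊆ Ioi 0) :
    ∃ a b : ℝ, 0 < a ∧ a < 1 ∧ 1 < b ∧ tsupport η ⊆ Ioo a b := by
  obtain ⟨B, hB⟩ := hc.isCompact.bddAbove
  rcases (tsupport η).eq_empty_or_nonempty with h | h
  · exact ⟨1 / 2, 2, by norm_num, by norm_num, by norm_num, by simp [h]⟩
  · obtain ⟨m, hm, hmin⟩ := hc.isCompact.exists_isLeast h
    have hm0 : 0 < m := hs hm
    refine ⟨min (m / 2) (1 / 2), max (B + 1) 2, by positivity, ?_, ?_, fun x hx => ⟨?_, ?_⟩⟩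
    · exact (min_le_right _ _).trans_lt (by norm_num)
    · exact lt_of_lt_of_le (by norm_num) (le_max_right _ _)
    · exact (min_le_left _ _).trans_lt (by linarith [hmin hx])
    · exact lt_of_lt_of_le (by linarith [hB hx]) (le_max_left _ _)

theorem setIntegral_Ioi_eq_intervalIntegral {a b : ℝ} (ha : 0 < a) (hab : a ≤ b) {f : ℝ → ℝ}
    (hf : ∀ x, x ∉ Ioo a b → f x = 0) : ∫ x in Ioi 0, f x = ∫ x in a..b, f x := by
  rw [intervalIntegral.integral_of_le hab]
  exact setIntegral_eq_of_subset_of_forall_sdiff_eq_zero measurableSet_Ioi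
    (fun x hx => ha.trans hx.1) fun x hx => hf x fun h => hx.2 ⟨h.1, h.2.le⟩

theorem intervalIntegrable_of_locallyIntegrableOn_Ioi {H : ℝ → ℝ}
    (hH : LocallyIntegrableOn H (Ioi 0)) {a b : ℝ} (ha : 0 < a) (hb : 0 < b) :
    IntervalIntegrable H volume a b := by
  rw [intervalIntegrable_iff]
  refine (hH.integrableOn_compact_subset (t := uIcc a b) ?_ isCompact_uIcc).mono_set
    uIoc_subset_uIcc
  intro x hx
  exact lt_of_lt_of_le (lt_min ha hb) hx.1

/-- The weak derivative of a primitive. -/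
theorem integral_primitive_mul_deriv {H : ℝ → ℝ} (hH : LocallyIntegrableOn H (Ioi 0))
    {η : ℝ → ℝ} (hη : ContDiff ℝ ∞ η) (hc : HasCompactSupport η) (hs : tsupport η ⊆ Ioi 0) :
    ∫ r in Ioi 0, (∫ t in 1..r, H t) * deriv η r = -∫ r in Ioi 0, H r * η r := by
  obtain ⟨a, b, ha, ha1, hb1, hsub⟩ := tsupport_subset_Icc_of_pos hc hs
  have hab : a ≤ b := (ha1.trans hb1).le
  have hη0 : ∀ x, x ∉ Ioo a b → η x = 0 := fun x hx =>
    image_eq_zero_of_notMem_tsupport fun h => hx (hsub h)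
  have hη1 : ∀ x, x ∉ Ioo a b → deriv η x = 0 := fun x hx => by
    by_contra h
    exact hx (hsub (support_deriv_subset h))
  rw [setIntegral_Ioi_eq_intervalIntegral ha hab fun x hx => by rw [hη1 x hx, mul_zero],
    setIntegral_Ioi_eq_intervalIntegral ha hab fun x hx => by rw [hη0 x hx, mul_zero]]
  have hHi : IntervalIntegrable H volume a b :=
    intervalIntegrable_of_locallyIntegrableOn_Ioi hH ha (ha.trans_le hab)
  have h1 : (1 : ℝ) ∈ uIcc a b := by rw [uIcc_of_le hab]; exact ⟨ha1.le, hb1.le⟩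
  -- Integration by parts for absolutely continuous functions, as `H` is only locally integrable;
  -- the boundary terms vanish with `η`.
  rw [(hHi.absolutelyContinuousOnInterval_intervalIntegral h1).integral_mul_deriv_eq_deriv_mul
    (hη.contDiffOn.of_le (by simp)).absolutelyContinuousOnInterval, hη0 a (by simp),
    hη0 b (by simp)]
  simp only [mul_zero, sub_zero, zero_sub, neg_inj]
  refine intervalIntegral.integral_congr_ae ?_
  filter_upwards [hHi.ae_hasDerivAt_integral] with x hx hxm
  rw [(hx (uIoc_subset_uIcc hxm) 1 h1).deriv]

/-- A smooth function with compact support in `(0, ∞)` and vanishing integral is the derivative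
of such a function. -/
theorem exists_primitive_of_integral_eq_zero {φ : ℝ → ℝ} (hφ : ContDiff ℝ ∞ φ)
    (hc : HasCompactSupport φ) (hs : tsupport φ ⊆ Ioi 0) (h0 : ∫ x, φ x = 0) :
    ∃ η : ℝ → ℝ, ContDiff ℝ ∞ η ∧ HasCompactSupport η ∧ tsupport η ⊆ Ioi 0 ∧ deriv η = φ := by
  obtain ⟨a, b, ha, ha1, hb1, hsub⟩ := tsupport_subset_Icc_of_pos hc hs
  have hab : a ≤ b := (ha1.trans hb1).le
  have hφ0 : ∀ x, x ∉ Ioo a b → φ x = 0 := fun x hx =>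
    image_eq_zero_of_notMem_tsupport fun h => hx (hsub h)
  have hd : ∀ x, HasDerivAt (fun x => ∫ t in a..x, φ t) (φ x) x := fun x =>
    intervalIntegral.integral_hasDerivAt_right (hφ.continuous.intervalIntegrable _ _)
      (hφ.continuous.stronglyMeasurableAtFilter _ _) hφ.continuous.continuousAt
  have hderiv : deriv (fun x => ∫ t in a..x, φ t) = φ := funext fun x => (hd x).deriv
  have hsupp : Function.support (fun x => ∫ t in a..x, φ t) ⊆ Icc a b := by
    intro x hx
    by_contra hxm
    refine hx ?_
    show ∫ t in a..x, φ t = 0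
    rcases lt_or_ge x a with h | h
    · rw [intervalIntegral.integral_symm, intervalIntegral.integral_of_le h.le,
        setIntegral_eq_zero_of_forall_eq_zero, neg_zero]
      intro t ht
      exact hφ0 t fun h' => absurd h'.1 (not_lt.2 ht.2)
    · have hxb : b < x := by
        by_contra h'
        exact hxm ⟨h, not_lt.1 h'⟩
      -- To the right of the support the primitive equals the total integral of `φ`, which is zero.
      rw [intervalIntegral.integral_of_le h, ← h0]
      exact setIntegral_eq_integral_of_forall_compl_eq_zero fun t ht =>
        hφ0 t fun h' => ht ⟨h'.1, (h'.2.trans hxb).le⟩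
  have hts : tsupport (fun x => ∫ t in a..x, φ t) ⊆ Icc a b :=
    closure_minimal hsupp isClosed_Icc
  refine ⟨fun x => ∫ t in a..x, φ t, ?_, HasCompactSupport.of_support_subset_isCompact isCompact_Icc hsupp,
    hts.trans fun x hx => ha.trans_le hx.1, hderiv⟩
  rw [contDiff_infty_iff_deriv, hderiv]
  exact ⟨fun x => (hd x).differentiableAt, hφ⟩

/-- The **du Bois-Reymond lemma** on `(0, ∞)`: a function with weak derivative `H` is almost
everywhere equal to a primitive of `H`. -/
theorem exists_ae_eq_primitive_of_weakDeriv {g H : ℝ → ℝ} (hg : LocallyIntegrableOn g (Ioi 0))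
    (hH : LocallyIntegrableOn H (Ioi 0))
    (hw : ∀ η : ℝ → ℝ, ContDiff ℝ ∞ η → HasCompactSupport η → tsupport η ⊆ Ioi 0 →
      ∫ r in Ioi 0, g r * deriv η r = -∫ r in Ioi 0, H r * η r) :
    ∃ C : ℝ, ∀ᵐ r ∂(volume.restrict (Ioi 0)), g r = C + ∫ t in 1..r, H t := by
  set G : ℝ → ℝ := fun r => ∫ t in 1..r, H t with hG
  have hGc : ContinuousOn G (Ioi 0) := by
    intro r (hr : 0 < r)
    have hi := intervalIntegrable_of_locallyIntegrableOn_Ioi hH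
      (a := min (r / 2) (1 / 2)) (b := max (r + 1) 2) (by positivity) (by positivity)
    have h1 : min (r / 2) (1 / 2) ≤ max (r + 1) 2 :=
      (min_le_right _ _).trans ((by norm_num : (1 / 2 : ℝ) ≤ 2).trans (le_max_right _ _))
    have hm : (1 : ℝ) ∈ uIcc (min (r / 2) (1 / 2)) (max (r + 1) 2) := by
      rw [uIcc_of_le h1]
      exact ⟨(min_le_right _ _).trans (by norm_num), le_trans (by norm_num) (le_max_right _ _)⟩
    have := intervalIntegral.continuousOn_primitive_interval' hi hm
    rw [uIcc_of_le h1] at this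
    refine (this.continuousAt (Icc_mem_nhds ?_ ?_)).continuousWithinAt
    · exact (min_le_left _ _).trans_lt (by linarith)
    · exact lt_of_lt_of_le (by linarith) (le_max_left _ _)
  have hf : LocallyIntegrableOn (g - G) (Ioi 0) :=
    hg.sub (hGc.locallyIntegrableOn measurableSet_Ioi)
  have hint : ∀ {k φ : ℝ → ℝ}, LocallyIntegrableOn k (Ioi 0) → Continuous φ →
      HasCompactSupport φ → tsupport φ ⊆ Ioi 0 → IntegrableOn (fun r => k r * φ r) (Ioi 0) := by
    intro k φ hk hφ hφc hφs
    have h1 : IntegrableOn (fun r => k r * φ r) (tsupport φ) :=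
      (hk.integrableOn_compact_subset hφs hφc.isCompact).mul_continuousOn hφ.continuousOn
        hφc.isCompact
    refine (h1.integrable_of_forall_notMem_eq_zero fun x hx => ?_).integrableOn
    rw [image_eq_zero_of_notMem_tsupport hx, mul_zero]
  have hweak : ∀ η : ℝ → ℝ, ContDiff ℝ ∞ η → HasCompactSupport η → tsupport η ⊆ Ioi 0 →
      ∫ r in Ioi 0, (g - G) r * deriv η r = 0 := by
    intro η h1 h2 h3
    have hd : Continuous (deriv η) := h1.continuous_deriv (by simp)
    have hds : tsupport (deriv η) ⊆ Ioi 0 :=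
      (closure_minimal support_deriv_subset (isClosed_tsupport _)).trans h3
    simp only [Pi.sub_apply, sub_mul]
    rw [integral_sub (hint hg hd h2.deriv hds)
      (hint (hGc.locallyIntegrableOn measurableSet_Ioi) hd h2.deriv hds), hw η h1 h2 h3,
      integral_primitive_mul_deriv hH h1 h2 h3, sub_self]
  -- A normalized bump supported in `[1, 3]`. Subtracting `(∫ φ) θ` from a test function `φ` makes
  -- its mean zero, hence makes it the derivative of a test function; testing `g - G` with `θ`
  -- identifies the constant.
  let θ0 : ContDiffBump (2 : ℝ) := ⟨1 / 2, 1, by norm_num, by norm_num⟩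
  set θ : ℝ → ℝ := θ0.normed volume with hθ
  have hθd : ContDiff ℝ ∞ θ := θ0.contDiff_normed
  have hθc : HasCompactSupport θ := θ0.hasCompactSupport_normed
  have hθi : ∫ x, θ x = 1 := θ0.integral_normed
  have hθs : tsupport θ ⊆ Ioi 0 := by
    rw [hθ, θ0.tsupport_normed_eq]
    intro x hx
    rw [Metric.mem_closedBall, Real.dist_eq, abs_le] at hx
    have : θ0.rOut = 1 := rfl
    rw [this] at hx
    show 0 < x
    linarith [hx.1]
  refine ⟨∫ r in Ioi 0, (g - G) r * θ r, ?_⟩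
  set C := ∫ r in Ioi 0, (g - G) r * θ r with hC
  rw [ae_restrict_iff' measurableSet_Ioi]
  have hfC : LocallyIntegrableOn (fun r => (g - G) r - C) (Ioi 0) :=
    hf.sub (continuousOn_const.locallyIntegrableOn measurableSet_Ioi)
  have := isOpen_Ioi.ae_eq_zero_of_integral_contDiff_smul_eq_zero hfC ?_
  · filter_upwards [this] with r hr hr0
    have := hr hr0
    simp only [Pi.sub_apply] at this
    linarith
  intro φ hφ hφc hφs
  have hφint : Integrable φ := hφ.continuous.integrable_of_hasCompactSupport hφc
  have hθint : Integrable θ := hθd.continuous.integrable_of_hasCompactSupport hθc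
  have hcθ : HasCompactSupport fun x => (∫ y, φ y) * θ x := hθc.mul_left
  have hsub : tsupport (fun x => φ x - (∫ y, φ y) * θ x) ⊆ Ioi 0 := by
    have : Function.support (fun x => φ x - (∫ y, φ y) * θ x) ⊆ tsupport φ ∪ tsupport θ := by
      intro x hx
      by_contra h
      rw [mem_union, not_or] at h
      refine hx ?_
      simp [image_eq_zero_of_notMem_tsupport h.1, image_eq_zero_of_notMem_tsupport h.2]
    exact (closure_minimal this ((isClosed_tsupport _).union (isClosed_tsupport _))).trans
      (union_subset hφs hθs)
  obtain ⟨η, e1, e2, e3, e4⟩ := exists_primitive_of_integral_eq_zero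
    (φ := fun x => φ x - (∫ y, φ y) * θ x) (hφ.sub (contDiff_const.mul hθd))
    (hφc.sub hcθ) hsub (by
      rw [integral_sub hφint (hθint.const_mul _), integral_const_mul, hθi, mul_one, sub_self])
  have hw0 := hweak η e1 e2 e3
  rw [e4] at hw0
  have i1 := hint hf hφ.continuous hφc hφs
  have i2 := hint hf hθd.continuous hθc hθs
  have hsplit : ∫ r in Ioi 0, (g - G) r * (φ r - (∫ y, φ y) * θ r) =
      (∫ r in Ioi 0, (g - G) r * φ r) - (∫ y, φ y) * C := by
    rw [hC, ← integral_const_mul, ← integral_sub i1 (i2.const_mul _)]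
    congr 1
    funext r
    ring
  rw [hsplit] at hw0
  have hφIoi : ∫ y, φ y = ∫ y in Ioi 0, φ y :=
    (setIntegral_eq_integral_of_forall_compl_eq_zero fun x hx =>
      image_eq_zero_of_notMem_tsupport fun h => hx (hφs h)).symm
  calc ∫ x, φ x • ((g - G) x - C) = ∫ x in Ioi 0, φ x • ((g - G) x - C) :=
        (setIntegral_eq_integral_of_forall_compl_eq_zero fun x hx => by
          rw [image_eq_zero_of_notMem_tsupport fun h => hx (hφs h), zero_smul]).symm
    _ = ∫ x in Ioi 0, ((g - G) x * φ x - C * φ x) := by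
        congr 1
        funext x
        simp only [smul_eq_mul]
        ring
    _ = 0 := by
        rw [integral_sub i1 (hφint.integrableOn.const_mul _), integral_const_mul, ← hφIoi]
        linarith

end DuBoisReymond

/-! ### Radial test fields and the weak derivative of spherical integrals -/

section RadialTestFields

variable {N : ℕ}

/-- The norm is smooth off the origin, and near the origin `κ ∘ ‖·‖` vanishes because the support of
`κ` stays away from zero. -/
theorem contDiff_comp_norm {κ : ℝ → ℝ} (hκ : ContDiff ℝ ∞ κ) (hs : tsupport κ ⊆ Ioi 0) :
    ContDiff ℝ ∞ fun x : Euc N => κ ‖x‖ := by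
  rw [contDiff_iff_contDiffAt]
  intro x
  by_cases hx : x = 0
  · have h0 : (0 : ℝ) ∉ tsupport κ := fun h => absurd (hs h) (by simp)
    rw [notMem_tsupport_iff_eventuallyEq] at h0
    have h1 : Filter.Tendsto (fun x : Euc N => ‖x‖) (nhds x) (nhds 0) := by
      simpa [hx] using (continuous_norm (E := Euc N)).tendsto x
    have h2 : (fun x : Euc N => κ ‖x‖) =ᶠ[nhds x] fun _ => 0 := h1.eventually h0
    exact contDiffAt_const.congr_of_eventuallyEq h2
  · exact hκ.contDiffAt.comp x (contDiffAt_norm ℝ hx)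

theorem hasCompactSupport_comp_norm {κ : ℝ → ℝ} (hc : HasCompactSupport κ) :
    HasCompactSupport fun x : Euc N => κ ‖x‖ := by
  obtain ⟨R, hR⟩ := hc.isCompact.bddAbove
  refine HasCompactSupport.intro (isCompact_closedBall (0 : Euc N) R) fun x hx => ?_
  refine image_eq_zero_of_notMem_tsupport fun h => hx ?_
  simpa using hR h

theorem hasFDerivAt_norm_euc {x : Euc N} (hx : x ≠ 0) :
    HasFDerivAt (fun y : Euc N => ‖y‖) (‖x‖⁻¹ • innerSL ℝ x) x := by
  have h1 := (hasStrictFDerivAt_norm_sq x).hasFDerivAt.sqrt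
    (pow_ne_zero 2 (norm_ne_zero_iff.2 hx))
  simp only [Real.sqrt_sq (norm_nonneg _)] at h1
  have h2 : (1 / (2 * ‖x‖)) • 2 • (innerSL ℝ) x = ‖x‖⁻¹ • innerSL ℝ x := by
    ext y
    simp only [smul_apply, nsmul_eq_mul, smul_eq_mul, Nat.cast_ofNat]
    field_simp
  exact h2 ▸ h1

/-- The divergence of the radial vector field `x ↦ κ(|x|) x`. -/
theorem sum_fderiv_radial {κ : ℝ → ℝ} (hκ : ContDiff ℝ ∞ κ) {x : Euc N} (hx : x ≠ 0) :
    ∑ j, fderiv ℝ (fun y : Euc N => y j * κ ‖y‖) x (EuclideanSpace.single j 1) =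
      N * κ ‖x‖ + ‖x‖ * deriv κ ‖x‖ := by
  have hn : ‖x‖ ≠ 0 := norm_ne_zero_iff.2 hx
  have h1 : HasFDerivAt (fun y : Euc N => κ ‖y‖) (deriv κ ‖x‖ • (‖x‖⁻¹ • innerSL ℝ x)) x :=
    ((hκ.differentiable (by simp)).differentiableAt.hasDerivAt).comp_hasFDerivAt x
      (hasFDerivAt_norm_euc hx)
  have h2 : ∀ j, fderiv ℝ (fun y : Euc N => y j * κ ‖y‖) x (EuclideanSpace.single j 1) =
      κ ‖x‖ + deriv κ ‖x‖ * ‖x‖⁻¹ * (x j) ^ 2 := by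
    intro j
    have h3 : HasFDerivAt (fun y : Euc N => y j) (EuclideanSpace.proj j : Euc N →L[ℝ] ℝ) x :=
      (EuclideanSpace.proj j : Euc N →L[ℝ] ℝ).hasFDerivAt
    rw [(h3.fun_mul h1).fderiv]
    simp [EuclideanSpace.inner_single_right]
    ring
  simp only [h2, Finset.sum_add_distrib, ← Finset.mul_sum]
  rw [← EuclideanSpace.real_norm_sq_eq]
  simp
  field_simp

/-- The radial component of a vector field. -/
noncomputable def radialPart (v : Fin N → Euc N → ℝ) (x : Euc N) : ℝ :=
  ∑ j, v j x * (x j / ‖x‖)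

/-- The spherical integrals of a Sobolev function have as weak derivative the spherical integrals
of the radial component of its gradient. -/
theorem sphereIntegral_weakDeriv {p : ℝ} [Fact (1 < p)] [Nontrivial (Euc N)]
    (u : Lp ℝ (ENNReal.ofReal p) (volume : Measure (Euc N)))
    (v : Fin N → Lp ℝ (ENNReal.ofReal p) (volume : Measure (Euc N)))
    (huv : ∀ j, IsWeakPartialDeriv j (u : Euc N → ℝ) (v j : Euc N → ℝ))
    {η : ℝ → ℝ} (hη : ContDiff ℝ ∞ η) (hc : HasCompactSupport η) (hs : tsupport η ⊆ Ioi 0) :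
    ∫ r in Ioi 0, sphereIntegral volume (u : Euc N → ℝ) r * deriv η r =
      -∫ r in Ioi 0, sphereIntegral volume (radialPart fun j => (v j : Euc N → ℝ)) r * η r := by
  obtain ⟨M, rfl⟩ : ∃ M, N = M + 1 := by
    cases N with
    | zero => exact absurd ‹Nontrivial (Euc 0)› (not_nontrivial _)
    | succ M => exact ⟨M, rfl⟩
  have hfin : Module.finrank ℝ (Euc (M + 1)) - 1 = M := by simp
  -- With dimension `M + 1`, this `κ` solves `(M+1) κ + t κ' = η' t^(-M)`. The divergence of `κ(|x|)
  -- x` is therefore `η'` divided by the polar Jacobian, and its radial component is `η` divided by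
  -- the same factor.
  set κ : ℝ → ℝ := fun t => η t * (t ^ (M + 1))⁻¹ with hκdef
  have hκs : tsupport κ ⊆ Ioi 0 := (tsupport_mul_subset_left).trans hs
  have hκc : HasCompactSupport κ := hc.mul_right
  have hκ : ContDiff ℝ ∞ κ := by
    rw [contDiff_iff_contDiffAt]
    intro t
    by_cases ht : t = 0
    · have h0 : t ∉ tsupport η := fun h => absurd (hs h) (by simp [ht])
      rw [notMem_tsupport_iff_eventuallyEq] at h0
      refine (contDiffAt_const (c := (0 : ℝ))).congr_of_eventuallyEq ?_
      filter_upwards [h0] with s hs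
      simp [hκdef, hs]
    · exact hη.contDiffAt.mul ((contDiffAt_id.pow _).inv (pow_ne_zero _ ht))
  have hκd : ∀ t, 0 < t → ((M + 1 : ℕ) : ℝ) * κ t + t * deriv κ t = deriv η t * (t ^ M)⁻¹ := by
    intro t ht
    have h1 : HasDerivAt κ (deriv η t * (t ^ (M + 1))⁻¹ +
        η t * (-(((M + 1 : ℕ) : ℝ) * t ^ M) / (t ^ (M + 1)) ^ 2)) t := by
      refine ((hη.differentiable (by simp)).differentiableAt.hasDerivAt).mul ?_
      have h2 : HasDerivAt (fun t : ℝ => t ^ (M + 1)) (((M + 1 : ℕ) : ℝ) * t ^ M) t := by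
        simpa using hasDerivAt_pow (M + 1) t
      exact h2.inv (pow_ne_zero _ ht.ne')
    rw [h1.deriv, hκdef]
    field_simp
    ring
  have hψ : ∀ j : Fin (M + 1), ContDiff ℝ ∞ fun y : Euc (M + 1) => y j * κ ‖y‖ := fun j =>
    ((EuclideanSpace.proj j : Euc (M + 1) →L[ℝ] ℝ).contDiff).mul (contDiff_comp_norm hκ hκs)
  have hψc : ∀ j : Fin (M + 1), HasCompactSupport fun y : Euc (M + 1) => y j * κ ‖y‖ := fun j =>
    (hasCompactSupport_comp_norm hκc).mul_left
  have hne : ∀ᵐ x : Euc (M + 1), x ≠ 0 := by simp [ae_iff]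
  have eL : (fun x => ∑ j, u x * fderiv ℝ (fun y : Euc (M + 1) => y j * κ ‖y‖) x
      (EuclideanSpace.single j 1)) =ᵐ[volume]
      fun x => u x * (fun r => deriv η r * (r ^ M)⁻¹) ‖x‖ := by
    filter_upwards [hne] with x hx
    rw [← Finset.mul_sum, sum_fderiv_radial hκ hx, hκd _ (norm_pos_iff.2 hx)]
  have eR : (fun x => ∑ j, v j x * (x j * κ ‖x‖)) =ᵐ[volume]
      fun x => radialPart (fun j => (v j : Euc (M + 1) → ℝ)) x *
        (fun r => η r * (r ^ M)⁻¹) ‖x‖ := by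
    filter_upwards [hne] with x hx
    have hn : ‖x‖ ≠ 0 := norm_ne_zero_iff.2 hx
    simp only [radialPart, Finset.sum_mul, hκdef]
    refine Finset.sum_congr rfl fun j _ => ?_
    rw [pow_succ]
    field_simp
  have iL : ∀ j ∈ (Finset.univ : Finset (Fin (M + 1))), Integrable (fun x => u x *
      fderiv ℝ (fun y : Euc (M + 1) => y j * κ ‖y‖) x (EuclideanSpace.single j 1)) volume :=
    fun j _ => integrable_Lp_mul_test u (test_fderiv j (hψ j) (hψc j)).1
      (test_fderiv j (hψ j) (hψc j)).2
  have iR : ∀ j ∈ (Finset.univ : Finset (Fin (M + 1))),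
      Integrable (fun x => v j x * (x j * κ ‖x‖)) volume :=
    fun j _ => integrable_Lp_mul_test (v j) (hψ j).continuous (hψc j)
  have key : ∫ x, u x * (fun r => deriv η r * (r ^ M)⁻¹) ‖x‖ =
      -∫ x, radialPart (fun j => (v j : Euc (M + 1) → ℝ)) x *
        (fun r => η r * (r ^ M)⁻¹) ‖x‖ := by
    rw [← integral_congr_ae eL, ← integral_congr_ae eR, integral_finsetSum _ iL,
      integral_finsetSum _ iR, ← Finset.sum_neg_distrib]
    exact Finset.sum_congr rfl fun j _ => huv j _ (hψ j) (hψc j)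
  have hcancel : ∀ w : Euc (M + 1) → ℝ, ∀ χ : ℝ → ℝ,
      ∫ r in Ioi (0 : ℝ), r ^ M * (sphereIntegral volume w r * (χ r * (r ^ M)⁻¹)) =
        ∫ r in Ioi 0, sphereIntegral volume w r * χ r := by
    intro w χ
    refine setIntegral_congr_fun measurableSet_Ioi fun r (hr : 0 < r) => ?_
    field_simp
  rw [integral_mul_radial (ψ := fun r => deriv η r * (r ^ M)⁻¹) volume ((integrable_finsetSum _ iL).congr eL),
    integral_mul_radial (ψ := fun r => η r * (r ^ M)⁻¹) volume ((integrable_finsetSum _ iR).congr eR), hfin, hcancel,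
    hcancel] at key
  exact key

end RadialTestFields

/-! ### Radial representatives with quantitative bounds -/

section RadialSobolev

variable {N : ℕ} {p : ℝ}

/-- The weight `∫_r^s t^{-(N-1)/(p-1)} dt`. -/
noncomputable def radialWeight (N : ℕ) (p r s : ℝ) : ℝ :=
  ∫ t in r..s, t ^ (-((N - 1 : ℝ) / (p - 1)))

/-- The total surface measure of the unit sphere of `ℝᴺ`. -/
noncomputable def sphereArea (N : ℕ) : ℝ :=
  (volume : Measure (Euc N)).toSphere.real univ

theorem sphereArea_pos [Nontrivial (Euc N)] : 0 < sphereArea N := by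
  rw [sphereArea, measureReal_def]
  refine ENNReal.toReal_pos ?_ (measure_ne_top _ _)
  rw [Measure.measure_univ_ne_zero]
  exact Measure.toSphere_ne_zero _

theorem cast_sub_one_of_nontrivial [Nontrivial (Euc N)] : ((N - 1 : ℕ) : ℝ) = N - 1 := by
  cases N with
  | zero => exact absurd ‹Nontrivial (Euc 0)› (not_nontrivial _)
  | succ M => simp

/-- The weight undoes the polar Jacobian on an annulus. The exponent in `radialWeight` arises from
`(N-1) - (N-1) p' = -(N-1)/(p-1)`, with `p'` the conjugate exponent. -/
theorem annulus_weight [Nontrivial (Euc N)] (hp : 1 < p) {r s : ℝ} (hr : 0 < r) (hrs : r ≤ s) :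
    MemLp (fun x : Euc N => (Ioc r s).indicator (fun t => (t ^ (N - 1))⁻¹) ‖x‖)
      (ENNReal.ofReal p.conjExponent) volume ∧
    ∫ x : Euc N, ((Ioc r s).indicator (fun t => (t ^ (N - 1))⁻¹) ‖x‖) ^ p.conjExponent =
      sphereArea N * radialWeight N p r s := by
  have hq : p.HolderConjugate p.conjExponent := Real.HolderConjugate.conjExponent hp
  set q := p.conjExponent with hqdef
  have hq0 : 0 < q := hq.symm.pos
  have hfin : Module.finrank ℝ (Euc N) = N := by simp
  set φ : ℝ → ℝ := (Ioc r s).indicator (fun t => (t ^ (N - 1))⁻¹) with hφ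
  have hφ0 : ∀ t, 0 ≤ φ t := indicator_nonneg fun t ht => by
    have : 0 < t := hr.trans ht.1
    positivity
  have hpow : ∀ t, 0 < t → t ^ (N - 1) * φ t ^ q =
      (Ioc r s).indicator (fun t => t ^ (-((N - 1 : ℝ) / (p - 1)))) t := by
    intro t ht
    by_cases h : t ∈ Ioc r s
    · rw [hφ, indicator_of_mem h, indicator_of_mem h, Real.inv_rpow (by positivity),
        ← Real.rpow_natCast, ← Real.rpow_mul ht.le, ← Real.rpow_neg ht.le, ← Real.rpow_add ht,
        cast_sub_one_of_nontrivial]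
      congr 1
      rw [hqdef, Real.conjExponent]
      have : p - 1 ≠ 0 := by linarith
      field_simp
      ring
    · rw [hφ, indicator_of_notMem h, indicator_of_notMem h, Real.zero_rpow hq0.ne', mul_zero]
  have hcont : ContinuousOn (fun t : ℝ => t ^ (-((N - 1 : ℝ) / (p - 1)))) (Icc r s) :=
    fun t ht => (Real.continuousAt_rpow_const _ _ (Or.inl (hr.trans_le ht.1).ne')).continuousWithinAt
  have hint : IntegrableOn (fun t : ℝ => t ^ (N - 1) • φ t ^ q) (Ioi 0) := by
    refine (integrableOn_congr_fun (fun t ht => hpow t ht) measurableSet_Ioi).2 ?_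
    exact ((integrable_indicator_iff measurableSet_Ioc).2
      (hcont.integrableOn_Icc.mono_set Ioc_subset_Icc_self)).integrableOn
  have hmeas : AEStronglyMeasurable (fun x : Euc N => φ ‖x‖) volume := by
    have : Measurable φ := Measurable.indicator (by fun_prop) measurableSet_Ioc
    exact (this.comp measurable_norm).aestronglyMeasurable
  constructor
  · rw [← integrable_norm_rpow_iff hmeas (by simpa using hq0) (by simp),
      ENNReal.toReal_ofReal hq0.le]
    have := (integrable_fun_norm_addHaar (volume : Measure (Euc N)) (f := fun t => φ t ^ q)).2
      (by rw [hfin]; exact hint)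
    simpa only [Real.norm_of_nonneg (hφ0 _)] using this
  · have h1 := integral_fun_norm_addHaar (volume : Measure (Euc N)) (fun t => φ t ^ q)
    simp only [h1, hfin, smul_eq_mul]
    rw [setIntegral_congr_fun measurableSet_Ioi hpow, setIntegral_indicator measurableSet_Ioc,
      inter_eq_right.2 (show Ioc r s ⊆ Ioi 0 from fun t ht => hr.trans ht.1), radialWeight,
      intervalIntegral.integral_of_le hrs, sphereArea, Measure.toSphere_real_apply_univ, hfin]
    simp [mul_assoc]

/-- Hölder's inequality on the annulus `r < |x| ≤ s`, between `w` and the inverse polar Jacobian. -/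
theorem sphereIntegral_holder [Nontrivial (Euc N)] (hp : 1 < p) {w : Euc N → ℝ}
    (hw : MemLp w (ENNReal.ofReal p) volume) {r s : ℝ} (hr : 0 < r) (hrs : r ≤ s) :
    IntegrableOn (sphereIntegral volume w) (Ioc r s) ∧
      ∫ t in Ioc r s, |sphereIntegral volume w t| ≤ (eLpNorm w (ENNReal.ofReal p) volume).toReal *
        (sphereArea N * radialWeight N p r s) ^ (1 / p.conjExponent) := by
  have hq : p.HolderConjugate p.conjExponent := Real.HolderConjugate.conjExponent hp
  have hp0 : 0 < p := by linarith
  obtain ⟨m1, e1⟩ := annulus_weight (N := N) hp hr hrs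
  have hφ0 : ∀ t, 0 ≤ (Ioc r s).indicator (fun t : ℝ => (t ^ (N - 1))⁻¹) t :=
    indicator_nonneg fun t ht => by
      have : 0 < t := hr.trans ht.1
      positivity
  have hpq : (ENNReal.ofReal p).HolderConjugate (ENNReal.ofReal p.conjExponent) :=
    hq.ennrealOfReal
  have hint := MemLp.integrable_mul hw m1
  obtain ⟨i1, h1⟩ := integrableOn_and_integral_abs_sphereIntegral_le volume
    (measurableSet_Ioc (a := r) (b := s)) (fun t ht => hr.trans ht.1) (q := N - 1) (by simp) hint
  refine ⟨i1, h1.trans ?_⟩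
  have h2 := integral_mul_le_Lp_mul_Lq_of_nonneg hq (μ := volume) (f := fun x => |w x|)
    (ae_of_all _ fun x => abs_nonneg _) (ae_of_all _ fun x => hφ0 ‖x‖) hw.abs m1
  rw [e1] at h2
  have e2 : (eLpNorm w (ENNReal.ofReal p) volume).toReal = (∫ x, |w x| ^ p) ^ (1 / p) := by
    rw [hw.eLpNorm_eq_integral_rpow_norm (by simpa using hp0) (by simp),
      ENNReal.toReal_ofReal hp0.le, ENNReal.toReal_ofReal (by positivity), one_div]
    rfl
  rw [e2]
  refine le_of_eq_of_le ?_ h2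
  congr 1
  funext x
  rw [abs_mul, abs_of_nonneg (hφ0 _)]

theorem radialPart_memLp {v : Fin N → Euc N → ℝ} (hp : 1 ≤ p)
    (hv : ∀ j, MemLp (v j) (ENNReal.ofReal p) volume) :
    MemLp (radialPart v) (ENNReal.ofReal p) volume ∧
      eLpNorm (radialPart v) (ENNReal.ofReal p) volume ≤
        ∑ j, eLpNorm (v j) (ENNReal.ofReal p) volume := by
  have hb : ∀ j x, ‖v j x * (x j / ‖x‖)‖ ≤ ‖v j x‖ := by
    intro j x
    rw [norm_mul]
    refine mul_le_of_le_one_right (norm_nonneg _) ?_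
    rw [norm_div, norm_norm]
    exact div_le_one_of_le₀ (PiLp.norm_apply_le x j) (norm_nonneg _)
  have hm : ∀ j, MemLp (fun x => v j x * (x j / ‖x‖)) (ENNReal.ofReal p) volume := by
    intro j
    refine (hv j).of_le ((hv j).1.mul ?_) (ae_of_all _ (hb j))
    have : Measurable fun x : Euc N => x j / ‖x‖ := by fun_prop
    exact this.aestronglyMeasurable
  have heq : radialPart v = ∑ j, fun x => v j x * (x j / ‖x‖) := by
    funext x
    simp [radialPart]
  rw [heq]
  refine ⟨memLp_finsetSum' _ fun j _ => hm j, ?_⟩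
  refine (eLpNorm_sum_le (fun j _ => (hm j).1) (by simpa using hp)).trans ?_
  exact Finset.sum_le_sum fun j _ => eLpNorm_mono (hb j)

/-- A radial function is recovered from its spherical integrals. -/
theorem radial_ae_eq_of_sphereIntegral [Nontrivial (Euc N)] {u : Euc N → ℝ} (hu : IsRadial u)
    {G : ℝ → ℝ} (hG : ∀ᵐ r ∂(volume.restrict (Ioi 0)), sphereIntegral volume u r = G r) :
    u =ᵐ[volume] fun x => G ‖x‖ / sphereArea N := by
  obtain ⟨g, hg⟩ := hu
  have hP := measurePreserving_polarMap (volume : Measure (Euc N))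
  have h1 := hP.quasiMeasurePreserving.ae hg
  have h2 : ∀ᵐ r ∂(radialMeasure (Module.finrank ℝ (Euc N) - 1)),
      ∀ᵐ σ : Metric.sphere (0 : Euc N) 1 ∂(volume : Measure (Euc N)).toSphere, u (r • (σ : Euc N)) = g ‖r • (σ : Euc N)‖ :=
    Measure.ae_ae_of_ae_prod (Measure.measurePreserving_swap.quasiMeasurePreserving.ae h1)
  rw [ae_radialMeasure_iff] at h2
  have h3 : ∀ᵐ r ∂(volume.restrict (Ioi (0 : ℝ))), g r = G r / sphereArea N := by
    filter_upwards [h2, hG, ae_restrict_mem measurableSet_Ioi] with r hr hr' (hr0 : 0 < r)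
    -- By Fubini, for almost every radius `u` is almost everywhere constant on the sphere, with
    -- value `g r`.
    have : sphereIntegral volume u r = sphereArea N * g r := by
      rw [sphereIntegral, integral_congr_ae (g := fun _ => g r), integral_const, sphereArea,
        smul_eq_mul]
      filter_upwards [hr] with σ hσ
      rw [hσ]
      simp [norm_smul, abs_of_pos hr0]
    rw [← hr', this, mul_div_cancel_left₀ _ sphereArea_pos.ne']
  filter_upwards [hg, (quasiMeasurePreserving_norm (volume : Measure (Euc N))).ae h3] with x h4 h5
  rw [h4, h5]

theorem abs_primitive_sub_le {H : ℝ → ℝ} (hH : LocallyIntegrableOn H (Ioi 0)) {r s : ℝ}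
    (hr : 0 < r) (hrs : r ≤ s) :
    |(∫ t in 1..s, H t) - ∫ t in 1..r, H t| ≤ ∫ t in Ioc r s, |H t| := by
  rw [intervalIntegral.integral_interval_sub_left
    (intervalIntegrable_of_locallyIntegrableOn_Ioi hH one_pos (hr.trans_le hrs))
    (intervalIntegrable_of_locallyIntegrableOn_Ioi hH one_pos hr),
    intervalIntegral.integral_of_le hrs]
  exact abs_integral_le_integral_abs

/-- The value at `r` differs from the value at any `t` in `(r, r+1]` by at most the integral of
`|H|`; averaging over `t` replaces the unknown constant `C` by an integral of `|g|`. -/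
theorem abs_le_integral_of_ae_eq_primitive {g H : ℝ → ℝ} (hg : LocallyIntegrableOn g (Ioi 0))
    (hH : LocallyIntegrableOn H (Ioi 0)) {C : ℝ}
    (hC : ∀ᵐ r ∂(volume.restrict (Ioi 0)), g r = C + ∫ t in 1..r, H t) {r : ℝ} (hr : 0 < r) :
    |C + ∫ t in 1..r, H t| ≤
      (∫ t in Ioc r (r + 1), |g t|) + ∫ t in Ioc r (r + 1), |H t| := by
  have hi : ∀ k : ℝ → ℝ, LocallyIntegrableOn k (Ioi 0) →
      IntegrableOn (fun t => |k t|) (Ioc r (r + 1)) := fun k hk =>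
    ((intervalIntegrable_of_locallyIntegrableOn_Ioi hk hr (by linarith : 0 < r + 1)).1).abs
  set A := ∫ t in Ioc r (r + 1), |H t| with hA
  -- The interval has length one, so constants can be written as integrals and the claim compared
  -- under one integral sign.
  have hcst : ∀ a : ℝ, ∫ _ in Ioc r (r + 1), a = a := by simp
  rw [← hcst A, ← integral_add (hi g hg) (integrable_const _), ← hcst |C + ∫ t in 1..r, H t|]
  refine integral_mono_ae (integrable_const _) ((hi g hg).add (integrable_const _)) ?_
  filter_upwards [ae_restrict_of_ae_restrict_of_subset
    (show Ioc r (r + 1) ⊆ Ioi 0 from fun t ht => hr.trans ht.1) hC,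
    ae_restrict_mem measurableSet_Ioc] with t ht hm
  have h2 := abs_primitive_sub_le hH hr hm.1.le
  have h3 : ∫ t in Ioc r t, |H t| ≤ A :=
    setIntegral_mono_set (hi H hH) (ae_of_all _ fun _ => abs_nonneg _)
      (Ioc_subset_Ioc_right hm.2).eventuallyLE
  simp only [ht]
  have h4 := abs_sub_abs_le_abs_sub (C + ∫ t in 1..r, H t) (C + ∫ x in 1..t, H x)
  rw [add_sub_add_left_eq_sub, abs_sub_comm] at h4
  linarith

/-- Radial Sobolev functions have a representative which is continuous away from the origin, with
quantitative control. -/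
theorem exists_radial_representative [Nontrivial (Euc N)] [Fact (1 < p)] :
    ∃ D : ℝ, 0 ≤ D ∧ ∀ u : SobolevW1 N p, IsRadial (SobolevW1.rep u) → ∃ f : ℝ → ℝ,
      (SobolevW1.rep u =ᵐ[volume] fun x => f ‖x‖) ∧
      (∀ r, 0 < r → |f r| ≤ D * ‖u‖ * radialWeight N p r (r + 1) ^ (1 / p.conjExponent)) ∧
      ∀ r s, 0 < r → r ≤ s →
        |f s - f r| ≤ D * ‖u‖ * radialWeight N p r s ^ (1 / p.conjExponent) := by
  have hp : 1 < p := Fact.out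
  set c := sphereArea N with hcdef
  have hc : 0 < c := sphereArea_pos
  set e := 1 / p.conjExponent with he
  have hJ : ∀ r s, 0 < r → r ≤ s → 0 ≤ radialWeight N p r s := fun r s hr hrs =>
    intervalIntegral.integral_nonneg hrs fun t ht => Real.rpow_nonneg (hr.trans_le ht.1).le _
  -- The `N` counts the partial derivatives in the radial part, the `1` is for `u` itself, `c ^ e`
  -- comes from Hölder, and division by `c` turns spherical integrals into values.
  refine ⟨(N + 1) * c ^ e / c, by positivity, fun u hu => ?_⟩
  have hU : MemLp (u.1.1 : Euc N → ℝ) (ENNReal.ofReal p) volume := Lp.memLp _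
  obtain ⟨hR, hRn⟩ := radialPart_memLp (p := p) hp.le
    (v := fun j => (u.1.2 j : Euc N → ℝ)) (fun j => Lp.memLp _)
  set H := sphereIntegral volume (radialPart fun j => (u.1.2 j : Euc N → ℝ)) with hH
  set g := sphereIntegral volume (u.1.1 : Euc N → ℝ) with hg
  have nU : (eLpNorm (u.1.1 : Euc N → ℝ) (ENNReal.ofReal p) volume).toReal ≤ ‖u‖ := by
    rw [← Lp.norm_def]
    exact norm_fst_le u.1
  have nR : (eLpNorm (radialPart fun j => (u.1.2 j : Euc N → ℝ)) (ENNReal.ofReal p)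
      volume).toReal ≤ N * ‖u‖ := by
    refine (ENNReal.toReal_mono ?_ hRn).trans ?_
    · exact ENNReal.sum_ne_top.2 fun j _ => Lp.eLpNorm_ne_top _
    · rw [ENNReal.toReal_sum fun j _ => Lp.eLpNorm_ne_top _]
      refine (Finset.sum_le_card_nsmul _ _ ‖u‖ fun j _ => ?_).trans (by simp)
      rw [← Lp.norm_def]
      exact (norm_le_pi_norm u.1.2 j).trans (norm_snd_le u.1)
  have loc : ∀ w : Euc N → ℝ, MemLp w (ENNReal.ofReal p) volume →
      LocallyIntegrableOn (sphereIntegral volume w) (Ioi 0) := by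
    intro w hw r (hr : 0 < r)
    refine ⟨Ioc (r / 2) (r + 1), mem_nhdsWithin_of_mem_nhds
      (Ioc_mem_nhds (by linarith) (by linarith)),
      (sphereIntegral_holder hp hw (by linarith) (by linarith)).1⟩
  obtain ⟨C, hC⟩ := exists_ae_eq_primitive_of_weakDeriv (loc _ hU) (loc _ hR)
    (fun η h1 h2 h3 => sphereIntegral_weakDeriv u.1.1 u.1.2 u.2 h1 h2 h3)
  have hpw : ∀ r s, 0 < r → r ≤ s → (c * radialWeight N p r s) ^ e =
      c ^ e * radialWeight N p r s ^ e := fun r s hr hrs =>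
    Real.mul_rpow hc.le (hJ r s hr hrs)
  have hHb : ∀ r s, 0 < r → r ≤ s →
      ∫ t in Ioc r s, |H t| ≤ N * ‖u‖ * (c ^ e * radialWeight N p r s ^ e) := by
    intro r s hr hrs
    refine (sphereIntegral_holder hp hR hr hrs).2.trans ?_
    rw [← hcdef, ← he, hpw r s hr hrs]
    exact mul_le_mul_of_nonneg_right nR
      (mul_nonneg (by positivity) (Real.rpow_nonneg (hJ r s hr hrs) _))
  have hgb : ∀ r s, 0 < r → r ≤ s →
      ∫ t in Ioc r s, |g t| ≤ ‖u‖ * (c ^ e * radialWeight N p r s ^ e) := by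
    intro r s hr hrs
    refine (sphereIntegral_holder hp hU hr hrs).2.trans ?_
    rw [← hcdef, ← he, hpw r s hr hrs]
    exact mul_le_mul_of_nonneg_right nU
      (mul_nonneg (by positivity) (Real.rpow_nonneg (hJ r s hr hrs) _))
  have hK : ∀ r s, 0 < r → r ≤ s → 0 ≤ ‖u‖ * (c ^ e * radialWeight N p r s ^ e) :=
    fun r s hr hrs => mul_nonneg (norm_nonneg _)
      (mul_nonneg (by positivity) (Real.rpow_nonneg (hJ r s hr hrs) _))
  have hD : ∀ J : ℝ, (N + 1) * c ^ e / c * ‖u‖ * J * c = (N + 1) * (‖u‖ * (c ^ e * J)) := by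
    intro J
    field_simp
  refine ⟨fun r => (C + ∫ t in 1..r, H t) / c, radial_ae_eq_of_sphereIntegral hu hC,
    fun r hr => ?_, fun r s hr hrs => ?_⟩
  · have h1 := abs_le_integral_of_ae_eq_primitive (loc _ hU) (loc _ hR) hC hr
    have h6 := hHb r (r + 1) hr (by linarith)
    have h7 := hgb r (r + 1) hr (by linarith)
    rw [abs_div, abs_of_pos hc, div_le_iff₀ hc, hD]
    linarith
  · have h1 := abs_primitive_sub_le (loc _ hR) hr hrs
    have h6 := hHb r s hr hrs
    have h7 := hK r s hr hrs
    rw [← sub_div, abs_div, abs_of_pos hc, div_le_iff₀ hc, add_sub_add_left_eq_sub, hD]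
    linarith

end RadialSobolev

/-! ### Convergence in `L¹` and relative compactness -/

section Convergence

open Filter Topology

variable {α : Type*} [MeasurableSpace α] {μ : Measure α}

/-- **Scheffé's lemma**. -/
theorem tendsto_integral_abs_sub_of_tendsto_integral {g : ℕ → α → ℝ} {g₀ : α → ℝ}
    (hg : ∀ k, Integrable (g k) μ) (hg₀ : Integrable g₀ μ) (hpos : ∀ k x, 0 ≤ g k x)
    (hlim : ∀ᵐ x ∂μ, Tendsto (fun k => g k x) atTop (𝓝 (g₀ x)))
    (hint : Tendsto (fun k => ∫ x, g k x ∂μ) atTop (𝓝 (∫ x, g₀ x ∂μ))) :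
    Tendsto (fun k => ∫ x, |g k x - g₀ x| ∂μ) atTop (𝓝 0) := by
  have hm : ∀ k, Integrable (fun x => max (g₀ x - g k x) 0) μ := fun k =>
    (hg₀.sub (hg k)).pos_part
  have h1 : Tendsto (fun k => ∫ x, max (g₀ x - g k x) 0 ∂μ) atTop (𝓝 (∫ _, (0 : ℝ) ∂μ)) := by
    refine tendsto_integral_of_dominated_convergence (fun x => |g₀ x|) (fun k => (hm k).1)
      hg₀.abs (fun k => ae_of_all _ fun x => ?_) ?_
    · rw [Real.norm_of_nonneg (le_max_right _ _)]
      exact max_le ((sub_le_self _ (hpos k x)).trans (le_abs_self _)) (abs_nonneg _)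
    · filter_upwards [hlim] with x hx
      have : Tendsto (fun k => max (g₀ x - g k x) 0) atTop (𝓝 (max (g₀ x - g₀ x) 0)) :=
        (hx.const_sub _).max tendsto_const_nhds
      simpa using this
  -- Pointwise, `|a - b| = (a - b) + 2 (b - a)⁺`; only the positive part needs domination, and `g₀`
  -- provides it.
  have h2 : ∀ k, ∫ x, |g k x - g₀ x| ∂μ =
      (∫ x, g k x ∂μ) - (∫ x, g₀ x ∂μ) + 2 * ∫ x, max (g₀ x - g k x) 0 ∂μ := by
    intro k
    rw [← integral_sub (hg k) hg₀, ← integral_const_mul,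
      ← integral_add (f := fun x => g k x - g₀ x) ((hg k).sub hg₀) ((hm k).const_mul 2)]
    congr 1
    funext x
    rcases le_total (g k x) (g₀ x) with h | h
    · rw [abs_of_nonpos (by linarith), max_eq_left (by linarith)]
      ring
    · rw [abs_of_nonneg (by linarith), max_eq_right (by linarith)]
      ring
  simp only [h2]
  have := (hint.sub_const (∫ x, g₀ x ∂μ)).add (h1.const_mul 2)
  simpa using this

/-- Dominated convergence with a convergent sequence of dominating functions. -/
theorem tendsto_eLpNorm_one_of_tendsto_dominating {f g : ℕ → α → ℝ} {f₀ g₀ : α → ℝ}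
    (hf : ∀ k, AEStronglyMeasurable (f k) μ) (hg : ∀ k, Integrable (g k) μ)
    (hg₀ : Integrable g₀ μ) (hfg : ∀ k, ∀ᵐ x ∂μ, |f k x| ≤ g k x)
    (hpos : ∀ k x, 0 ≤ g k x)
    (hflim : ∀ᵐ x ∂μ, Tendsto (fun k => f k x) atTop (𝓝 (f₀ x)))
    (hglim : ∀ᵐ x ∂μ, Tendsto (fun k => g k x) atTop (𝓝 (g₀ x)))
    (hint : Tendsto (fun k => ∫ x, g k x ∂μ) atTop (𝓝 (∫ x, g₀ x ∂μ))) :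
    Tendsto (fun k => eLpNorm (f k - f₀) 1 μ) atTop (𝓝 0) := by
  have hf₀ : AEStronglyMeasurable f₀ μ := aestronglyMeasurable_of_tendsto_ae atTop hf hflim
  have hd : ∀ k, AEStronglyMeasurable (fun x => |f k x - f₀ x|) μ := fun k =>
    ((hf k).sub hf₀).norm
  have hfg₀ : ∀ᵐ x ∂μ, |f₀ x| ≤ g₀ x := by
    filter_upwards [hflim, hglim, ae_all_iff.2 hfg] with x h1 h2 h3
    exact le_of_tendsto_of_tendsto' h1.abs h2 h3
  have hi : ∀ k, Integrable (fun x => |f k x - f₀ x|) μ := by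
    intro k
    refine ((hg k).add hg₀).mono' (hd k) ?_
    filter_upwards [hfg k, hfg₀] with x h1 h2
    rw [Real.norm_of_nonneg (abs_nonneg _)]
    exact (abs_sub _ _).trans (add_le_add h1 h2)
  -- Since `|f_k - f₀| ≤ g_k + g₀ ≤ 2 g₀ + |g_k - g₀|`, the difference is at most its truncation at
  -- the fixed level `2 g₀` plus `|g_k - g₀|`. Ordinary dominated convergence handles the first and
  -- Scheffé the second.
  have hmeas : ∀ k, AEStronglyMeasurable (fun x => min |f k x - f₀ x| (2 * g₀ x)) μ := fun k =>
    (hd k).inf (hg₀.1.const_mul 2)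
  have hmb : ∀ k, ∀ᵐ x ∂μ, ‖min |f k x - f₀ x| (2 * g₀ x)‖ ≤ 2 * g₀ x := by
    intro k
    filter_upwards [hfg₀] with x hx
    have : 0 ≤ g₀ x := (abs_nonneg _).trans hx
    rw [Real.norm_of_nonneg (le_min (abs_nonneg _) (by positivity))]
    exact min_le_right _ _
  have hmin : Tendsto (fun k => ∫ x, min |f k x - f₀ x| (2 * g₀ x) ∂μ) atTop
      (𝓝 (∫ _, (0 : ℝ) ∂μ)) := by
    refine tendsto_integral_of_dominated_convergence (fun x => 2 * g₀ x) hmeas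
      (hg₀.const_mul 2) hmb ?_
    filter_upwards [hflim, hfg₀] with x h1 h2
    have : 0 ≤ g₀ x := (abs_nonneg _).trans h2
    have h3 : Tendsto (fun k => min |f k x - f₀ x| (2 * g₀ x)) atTop
        (𝓝 (min |f₀ x - f₀ x| (2 * g₀ x))) := (h1.sub_const _).abs.min tendsto_const_nhds
    rwa [sub_self, abs_zero, min_eq_left (by positivity)] at h3
  have hmi : ∀ k, Integrable (fun x => min |f k x - f₀ x| (2 * g₀ x)) μ := fun k =>
    (hg₀.const_mul 2).mono' (hmeas k) (hmb k)
  have hreal : Tendsto (fun k => ∫ x, |f k x - f₀ x| ∂μ) atTop (𝓝 0) := by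
    have hs := hmin.add (tendsto_integral_abs_sub_of_tendsto_integral hg hg₀ hpos hglim hint)
    rw [integral_zero, add_zero] at hs
    refine squeeze_zero (fun k => integral_nonneg fun x => abs_nonneg _) (fun k => ?_) hs
    have hab : Integrable (fun x => |g k x - g₀ x|) μ := ((hg k).sub hg₀).abs
    rw [← integral_add (hmi k) hab]
    refine integral_mono_ae (hi k) ((hmi k).add hab) ?_
    filter_upwards [hfg k, hfg₀] with x h1 h2
    have h3 : |f k x - f₀ x| ≤ 2 * g₀ x + |g k x - g₀ x| := by
      have := abs_sub (f k x) (f₀ x)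
      have := le_abs_self (g k x - g₀ x)
      linarith
    rcases le_total |f k x - f₀ x| (2 * g₀ x) with h | h
    · simp only [min_eq_left h]
      linarith [abs_nonneg (g k x - g₀ x)]
    · simp only [min_eq_right h]
      exact h3
  have heq : ∀ k, eLpNorm (f k - f₀) 1 μ = ENNReal.ofReal (∫ x, |f k x - f₀ x| ∂μ) := by
    intro k
    rw [eLpNorm_one_eq_lintegral_enorm, ofReal_integral_eq_lintegral_ofReal (hi k)
      (ae_of_all _ fun x => abs_nonneg _)]
    refine lintegral_congr fun x => ?_
    rw [← ofReal_norm, Real.norm_eq_abs, Pi.sub_apply]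
  simp only [heq]
  simpa using ENNReal.tendsto_ofReal hreal

/-- Almost everywhere convergence implies `L¹` convergence if the sequence is dominated up to
uniformly small remainders. -/
theorem memLp_and_tendsto_of_dominated_up_to {f : ℕ → α → ℝ} {f₀ : α → ℝ}
    (hf : ∀ k, AEStronglyMeasurable (f k) μ)
    (hlim : ∀ᵐ x ∂μ, Tendsto (fun k => f k x) atTop (𝓝 (f₀ x)))
    (hdom : ∀ ε : ℝ, 0 < ε → ∃ S : Set α, MeasurableSet S ∧ ∃ G : α → ℝ, IntegrableOn G S μ ∧
      ∀ k, (∀ᵐ x ∂(μ.restrict S), |f k x| ≤ G x) ∧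
        ∫⁻ x in Sᶜ, ‖f k x‖ₑ ∂μ ≤ ENNReal.ofReal ε) :
    MemLp f₀ 1 μ ∧ Tendsto (fun k => eLpNorm (f k - f₀) 1 μ) atTop (𝓝 0) := by
  have hf₀ : AEStronglyMeasurable f₀ μ := aestronglyMeasurable_of_tendsto_ae atTop hf hlim
  -- Fatou's lemma passes the uniform tail bound to the limit.
  have htail : ∀ (S : Set α) (ε : ℝ≥0∞), (∀ k, ∫⁻ x in Sᶜ, ‖f k x‖ₑ ∂μ ≤ ε) →
      ∫⁻ x in Sᶜ, ‖f₀ x‖ₑ ∂μ ≤ ε := by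
    intro S ε h
    have h1 : ∫⁻ x in Sᶜ, ‖f₀ x‖ₑ ∂μ = ∫⁻ x in Sᶜ, liminf (fun k => ‖f k x‖ₑ) atTop ∂μ :=
      lintegral_congr_ae (by
        filter_upwards [ae_restrict_of_ae hlim] with x hx using hx.enorm.liminf_eq.symm)
    rw [h1]
    refine (lintegral_liminf_le' fun k => (hf k).aemeasurable.enorm.restrict).trans ?_
    exact (liminf_le_liminf (Eventually.of_forall h)).trans (by simp)
  constructor
  · rw [memLp_one_iff_integrable]
    refine ⟨hf₀, ?_⟩
    obtain ⟨S, hS, G, hG, h⟩ := hdom 1 one_pos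
    rw [hasFiniteIntegral_iff_enorm, ← lintegral_add_compl _ hS]
    refine ENNReal.add_lt_top.2 ⟨?_, (htail S _ fun k => (h k).2).trans_lt ENNReal.ofReal_lt_top⟩
    have : IntegrableOn f₀ S μ := by
      refine hG.mono' hf₀.restrict ?_
      filter_upwards [ae_restrict_of_ae hlim, ae_all_iff.2 fun k => (h k).1] with x h1 h2
      exact le_of_tendsto' h1.abs h2
    exact this.2
  · rw [ENNReal.tendsto_nhds_zero]
    intro ε hε
    rcases eq_or_ne ε ⊤ with rfl | hε'
    · exact Eventually.of_forall fun _ => le_top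
    -- A quarter for each of the tails of `f_k` and `f₀`; the remaining half is spent on `S`.
    have hδ : 0 < ε.toReal / 4 := by
      have := ENNReal.toReal_pos hε.ne' hε'
      positivity
    obtain ⟨S, hS, G, hG, h⟩ := hdom _ hδ
    have h4 : ENNReal.ofReal (ε.toReal / 4) = ε / 4 := by
      rw [ENNReal.ofReal_div_of_pos (by norm_num), ENNReal.ofReal_toReal hε']
      simp
    have h1 := tendsto_lintegral_norm_of_dominated_convergence (fun k => (hf k).restrict) hG.2
      (fun k => (h k).1) (ae_restrict_of_ae hlim)
    rw [ENNReal.tendsto_nhds_zero] at h1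
    filter_upwards [h1 (ε / 2) (ENNReal.half_pos hε.ne')] with k hk
    rw [eLpNorm_one_eq_lintegral_enorm, ← lintegral_add_compl _ hS]
    have h2 : ∫⁻ x in Sᶜ, ‖(f k - f₀) x‖ₑ ∂μ ≤ ε / 4 + ε / 4 := by
      rw [← h4]
      calc ∫⁻ x in Sᶜ, ‖(f k - f₀) x‖ₑ ∂μ ≤ ∫⁻ x in Sᶜ, (‖f k x‖ₑ + ‖f₀ x‖ₑ) ∂μ :=
            lintegral_mono fun x => enorm_sub_le
        _ = (∫⁻ x in Sᶜ, ‖f k x‖ₑ ∂μ) + ∫⁻ x in Sᶜ, ‖f₀ x‖ₑ ∂μ :=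
            lintegral_add_left' (hf k).aemeasurable.enorm.restrict _
        _ ≤ _ := add_le_add (h k).2 (htail S _ fun k => (h k).2)
    have h3 : ∫⁻ x in S, ‖(f k - f₀) x‖ₑ ∂μ ≤ ε / 2 := by
      refine le_of_eq_of_le (lintegral_congr fun x => ?_) hk
      rw [← ofReal_norm, Pi.sub_apply]
    refine (add_le_add h3 h2).trans (le_of_eq ?_)
    have h5 : ε / 4 + ε / 4 = ε / 2 := by
      rw [← two_mul, div_eq_mul_inv, div_eq_mul_inv, mul_left_comm]
      congr 1
      rw [show (4 : ℝ≥0∞) = 2 * 2 by norm_num, ENNReal.mul_inv (by simp) (by simp), ← mul_assoc,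
        ENNReal.mul_inv_cancel (by simp) (by simp), one_mul]
    rw [h5, ENNReal.add_halves]

/-- A sequence in the closure is shadowed by one in `s` at distance below `1/(k+1)`, and both have
the same subsequential limits. -/
theorem isCompact_closure_of_subseq_tendsto {X : Type*} [PseudoMetricSpace X] {s : Set X}
    (hs : ∀ x : ℕ → X, (∀ k, x k ∈ s) → ∃ a, ∃ φ : ℕ → ℕ, StrictMono φ ∧
      Tendsto (x ∘ φ) atTop (𝓝 a)) : IsCompact (closure s) := by
  refine IsSeqCompact.isCompact fun y hy => ?_
  have hpos : ∀ k : ℕ, (0 : ℝ) < 1 / ((k : ℝ) + 1) := fun k => by positivity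
  choose x hx hxy using fun k => Metric.mem_closure_iff.1 (hy k) _ (hpos k)
  obtain ⟨a, φ, hφ, ha⟩ := hs x hx
  refine ⟨a, mem_closure_of_tendsto ha (Eventually.of_forall fun k => hx _), φ, hφ, ?_⟩
  refine (tendsto_iff_of_dist ?_).1 ha
  have h0 := (tendsto_one_div_add_atTop_nhds_zero_nat (𝕜 := ℝ)).comp hφ.tendsto_atTop
  refine squeeze_zero (fun _ => dist_nonneg) (fun k => ?_) h0
  rw [dist_comm]
  exact (hxy (φ k)).le

end Convergence

/-! ### Measurability of superpositions -/

section Caratheodory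

open Filter Topology

variable {N m : ℕ} {F : ℝ → Euc m → ℝ}

theorem ae_norm_of_ae_Ici [Nontrivial (Euc N)] {P : ℝ → Prop}
    (h : ∀ᵐ r ∂(volume.restrict (Ici (0 : ℝ))), P r) : ∀ᵐ x : Euc N, P ‖x‖ :=
  (quasiMeasurePreserving_norm (volume : Measure (Euc N))).ae
    (ae_restrict_of_ae_restrict_of_subset Ioi_subset_Ici_self h)

theorem IsCaratheodory.ae_continuous (hF : IsCaratheodory F) [Nontrivial (Euc N)] :
    ∀ᵐ x : Euc N, Continuous (F ‖x‖) := by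
  obtain ⟨Γ, h0, -, hc⟩ := hF
  refine ae_norm_of_ae_Ici (P := fun r => Continuous (F r)) ?_
  filter_upwards [ae_restrict_mem measurableSet_Ici,
    ae_restrict_of_ae (measure_eq_zero_iff_ae_notMem.1 h0)] with r hr hr'
  exact hc r ⟨hr, hr'⟩

theorem IsCaratheodory.aemeasurable_comp_norm (hF : IsCaratheodory F) [Nontrivial (Euc N)]
    (s : Euc m) : AEMeasurable (fun x : Euc N => F ‖x‖ s) volume := by
  obtain ⟨Γ, h0, hm, -⟩ := hF
  have h1 : (Ici (0 : ℝ) \ Γ : Set ℝ) =ᵐ[volume] Ici 0 := sdiff_null_ae_eq_self h0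
  have h2 := hm s
  rw [Measure.restrict_congr_set h1] at h2
  exact (h2.mono_measure (Measure.restrict_mono Ioi_subset_Ici_self le_rfl)).comp_quasiMeasurePreserving
    (quasiMeasurePreserving_norm (volume : Measure (Euc N)))

/-- The superposition of a Carathéodory function with a measurable function is measurable. -/
theorem IsCaratheodory.aestronglyMeasurable_nemytskii (hF : IsCaratheodory F)
    [Nontrivial (Euc N)] {U : Fin m → Euc N → ℝ}
    (hU : ∀ i, AEStronglyMeasurable (U i) volume) :
    AEStronglyMeasurable (nemytskii F U) volume := by
  have hV : AEStronglyMeasurable (fun x => (WithLp.toLp 2 fun i => U i x : Euc m)) volume := by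
    have h1 : AEMeasurable (fun x => (WithLp.toLp 2 fun i => U i x : Euc m)) volume :=
      (WithLp.measurable_toLp 2 _).comp_aemeasurable
        (aemeasurable_pi_lambda _ fun i => (hU i).aemeasurable)
    exact h1.aestronglyMeasurable
  set V := hV.mk _ with hVdef
  have hVm : StronglyMeasurable V := hV.stronglyMeasurable_mk
  -- On each fibre of a simple function the second argument of `F` is constant, so measurability in
  -- `r` suffices. Continuity in `s` then carries measurability to the limit of simple
  -- approximations.
  have hsimple : ∀ f : SimpleFunc (Euc N) (Euc m),
      AEStronglyMeasurable (fun x => F ‖x‖ (f x)) volume := by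
    intro f
    have : (fun x => F ‖x‖ (f x)) =
        fun x => ∑ s ∈ f.range, (f ⁻¹' {s}).indicator (fun x => F ‖x‖ s) x := by
      funext x
      rw [Finset.sum_eq_single (f x)]
      · simp
      · intro s _ hs
        exact indicator_of_notMem (fun h => hs (by simpa using h.symm)) _
      · intro h
        exact absurd (f.mem_range_self x) h
    rw [this]
    refine Finset.aestronglyMeasurable_fun_sum _ fun s _ => ?_
    exact (hF.aemeasurable_comp_norm s).aestronglyMeasurable.indicator (f.measurableSet_fiber s)
  refine (aestronglyMeasurable_of_tendsto_ae (f := fun k x => F ‖x‖ (hVm.approx k x))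
    (g := fun x => F ‖x‖ (V x)) atTop (fun k => hsimple _) ?_).congr ?_
  · filter_upwards [hF.ae_continuous (N := N)] with x hx
    exact (hx.tendsto _).comp (hVm.tendsto_approx x)
  · filter_upwards [hV.ae_eq_mk] with x hx
    simp only [nemytskii, hx, hVdef]

end Caratheodory

/-! ### Growth bounds and continuity on `L^p ∩ L^q` -/

section Growth

open Filter Topology

variable {N m : ℕ} {F : ℝ → Euc m → ℝ} {p q : ℝ} {l : Fin m → ℝ}

theorem norm_euc_le_sum_abs (s : Euc m) : ‖s‖ ≤ ∑ i, |s i| := by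
  refine abs_le_of_sq_le_sq' ?_ (Finset.sum_nonneg fun i _ => abs_nonneg _) |>.2
  rw [EuclideanSpace.real_norm_sq_eq]
  calc ∑ i, s i ^ 2 = ∑ i, |s i| ^ 2 := by simp
    _ ≤ _ := Finset.sum_sq_le_sq_sum_of_nonneg fun i _ => abs_nonneg _

theorem norm_euc_rpow_le (hp : 1 ≤ p) (s : Euc m) :
    ‖s‖ ^ p ≤ (m : ℝ) ^ (p - 1) * ∑ i, |s i| ^ p := by
  refine (Real.rpow_le_rpow (norm_nonneg _) (norm_euc_le_sum_abs s) (by linarith)).trans ?_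
  simpa using Real.rpow_sum_le_const_mul_sum_rpow Finset.univ (fun i => s i) hp

theorem rpow_le_rpow_add_rpow {t a b c : ℝ} (ht : 0 ≤ t) (ha : 0 < a) (hab : a ≤ b)
    (hbc : b ≤ c) : t ^ b ≤ t ^ a + t ^ c := by
  rcases ht.eq_or_lt with rfl | ht0
  · rw [Real.zero_rpow (by linarith), Real.zero_rpow (by linarith), Real.zero_rpow (by linarith)]
    simp
  rcases le_total t 1 with h | h
  · have := Real.rpow_le_rpow_of_exponent_ge ht0 h hab
    have := Real.rpow_nonneg ht c
    linarith
  · have := Real.rpow_le_rpow_of_exponent_le h hbc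
    have := Real.rpow_nonneg ht a
    linarith

theorem GrowthAbs.exists_ae_abs_nemytskii_le [Nontrivial (Euc N)] (hF : GrowthAbs F p l)
    (hp : 1 ≤ p) : ∃ K : ℝ, 0 ≤ K ∧ ∀ᵐ x : Euc N, ∀ s : Euc m,
      |F ‖x‖ s| ≤ K * ∑ i, (|s i| ^ p + |s i| ^ (l i + p)) := by
  obtain ⟨K, hK, h⟩ := hF
  have hm : (0 : ℝ) ≤ (m : ℝ) ^ (p - 1) := by positivity
  refine ⟨K * ((m : ℝ) ^ (p - 1) + 1), by positivity, ?_⟩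
  refine ae_norm_of_ae_Ici (P := fun r => ∀ s : Euc m, |F r s| ≤
    K * ((m : ℝ) ^ (p - 1) + 1) * ∑ i, (|s i| ^ p + |s i| ^ (l i + p))) ?_
  filter_upwards [h] with r hr s
  refine (hr s).trans ?_
  rw [mul_assoc]
  refine mul_le_mul_of_nonneg_left ?_ hK.le
  have h1 := norm_euc_rpow_le hp s
  have h2 : 0 ≤ ∑ i, |s i| ^ p := Finset.sum_nonneg fun i _ => by positivity
  have h3 : 0 ≤ (m : ℝ) ^ (p - 1) * ∑ i, |s i| ^ (l i + p) :=
    mul_nonneg hm (Finset.sum_nonneg fun i _ => by positivity)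
  rw [Finset.sum_add_distrib, add_mul, one_mul, mul_add]
  linarith

theorem MemLp.integrable_abs_rpow {α : Type*} [MeasurableSpace α] {μ : Measure α} {u : α → ℝ}
    (hp : 0 < p) (hu : MemLp u (ENNReal.ofReal p) μ) : Integrable (fun x => |u x| ^ p) μ := by
  have := hu.integrable_norm_rpow (by simpa using hp) (by simp)
  simpa [ENNReal.toReal_ofReal hp.le] using this

theorem integral_abs_rpow_eq_norm_rpow {α : Type*} [MeasurableSpace α] {μ : Measure α}
    (hp : 0 < p) (u : Lp ℝ (ENNReal.ofReal p) μ) : ∫ x, |u x| ^ p ∂μ = ‖u‖ ^ p := by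
  have h0 : 0 ≤ ∫ x, |u x| ^ p ∂μ := integral_nonneg fun x => by positivity
  rw [Lp.norm_def, (Lp.memLp u).eLpNorm_eq_integral_rpow_norm (by simpa using hp) (by simp),
    ENNReal.toReal_ofReal hp.le, ENNReal.toReal_ofReal (by positivity)]
  simp only [Real.norm_eq_abs]
  rw [← Real.rpow_mul h0, inv_mul_cancel₀ hp.ne', Real.rpow_one]

theorem LpInter.rep_aesm [Fact (1 < p)] [Fact (1 < q)] (u : LpInter N p q) :
    AEStronglyMeasurable (LpInter.rep u) volume := Lp.aestronglyMeasurable _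

theorem LpInter.rep_ae_eq_snd [Fact (1 < p)] [Fact (1 < q)] (u : LpInter N p q) :
    LpInter.rep u =ᵐ[volume] (u.1.2 : Euc N → ℝ) := u.2

theorem LpInter.integrable_and_integral [hp : Fact (1 < p)] [hq : Fact (1 < q)]
    (u : LpInter N p q) :
    Integrable (fun x => |LpInter.rep u x| ^ p + |LpInter.rep u x| ^ q) volume ∧
      ∫ x, (|LpInter.rep u x| ^ p + |LpInter.rep u x| ^ q) = ‖u.1.1‖ ^ p + ‖u.1.2‖ ^ q := by
  have hp0 : 0 < p := one_pos.trans hp.out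
  have hq0 : 0 < q := one_pos.trans hq.out
  have h1 : Integrable (fun x => |LpInter.rep u x| ^ p) volume :=
    MemLp.integrable_abs_rpow hp0 (Lp.memLp u.1.1)
  have e : (fun x => |LpInter.rep u x| ^ q) =ᵐ[volume] fun x => |u.1.2 x| ^ q := by
    filter_upwards [LpInter.rep_ae_eq_snd u] with x hx
    rw [hx]
  have h2 : Integrable (fun x => |LpInter.rep u x| ^ q) volume :=
    (MemLp.integrable_abs_rpow hq0 (Lp.memLp u.1.2)).congr e.symm
  refine ⟨h1.add h2, ?_⟩
  rw [integral_add h1 h2, integral_congr_ae e, integral_abs_rpow_eq_norm_rpow hq0]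
  congr 1
  exact integral_abs_rpow_eq_norm_rpow hp0 u.1.1

/-- Convergent sequences of tuples in `L^p` have subsequences converging almost everywhere. -/
theorem exists_subseq_tendsto_ae {α ι : Type*} [MeasurableSpace α] {μ : Measure α} [Fintype ι]
    {p : ℝ≥0∞} [hp : Fact (1 ≤ p)] {u : ℕ → ι → Lp ℝ p μ} {u₀ : ι → Lp ℝ p μ}
    (h : ∀ i, Tendsto (fun k => u k i) atTop (𝓝 (u₀ i))) :
    ∃ φ : ℕ → ℕ, StrictMono φ ∧
      ∀ᵐ x ∂μ, ∀ i, Tendsto (fun k => u (φ k) i x) atTop (𝓝 (u₀ i x)) := by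
  -- Summing the differences over the components lets a single extraction serve all of them.
  set d : ℕ → α → ℝ := fun k => ∑ i, fun x => ‖u k i x - u₀ i x‖ with hd
  have hm : ∀ k i, AEStronglyMeasurable (fun x => ‖u k i x - u₀ i x‖) μ := fun k i =>
    ((Lp.aestronglyMeasurable _).sub (Lp.aestronglyMeasurable _)).norm
  have hsum : Tendsto (fun k => ∑ i, eLpNorm (⇑(u k i) - ⇑(u₀ i)) p μ) atTop (𝓝 0) := by
    have := tendsto_finsetSum (Finset.univ : Finset ι) fun i _ =>
      (Lp.tendsto_Lp_iff_tendsto_eLpNorm' _ _).1 (h i)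
    simpa using this
  have hd0 : Tendsto (fun k => eLpNorm (d k - 0) p μ) atTop (𝓝 0) := by
    refine tendsto_of_tendsto_of_tendsto_of_le_of_le tendsto_const_nhds hsum
      (fun _ => zero_le) fun k => ?_
    rw [sub_zero]
    refine (eLpNorm_sum_le (fun i _ => hm k i) hp.out).trans (le_of_eq ?_)
    exact Finset.sum_congr rfl fun i _ => eLpNorm_norm (u k i - u₀ i : α → ℝ)
  have hdm : ∀ k, AEStronglyMeasurable (d k) μ := fun k =>
    Finset.aestronglyMeasurable_sum _ fun i _ => hm k i
  obtain ⟨φ, hφ, hae⟩ := (tendstoInMeasure_of_tendsto_eLpNorm (zero_lt_one.trans_le hp.out).ne'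
    hdm aestronglyMeasurable_zero hd0).exists_seq_tendsto_ae
  refine ⟨φ, hφ, ?_⟩
  filter_upwards [hae] with x hx i
  rw [tendsto_iff_norm_sub_tendsto_zero]
  refine squeeze_zero (fun _ => norm_nonneg _) (fun k => ?_) hx
  simp only [hd, Finset.sum_apply]
  exact Finset.single_le_sum (f := fun i => ‖u (φ k) i x - u₀ i x‖)
    (fun i _ => norm_nonneg _) (Finset.mem_univ i)

theorem tendsto_nemytskii {U : ℕ → Fin m → Euc N → ℝ} {U₀ : Fin m → Euc N → ℝ} {x : Euc N}
    (hc : Continuous (F ‖x‖)) (h : ∀ i, Tendsto (fun k => U k i x) atTop (𝓝 (U₀ i x))) :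
    Tendsto (fun k => nemytskii F (U k) x) atTop (𝓝 (nemytskii F U₀ x)) :=
  (hc.tendsto _).comp (((PiLp.continuous_toLp 2 _).tendsto _).comp (tendsto_pi_nhds.2 h))

theorem nemytskiiContinuousOn_univ [Nontrivial (Euc N)] [hp : Fact (1 < p)] [hq : Fact (1 < q)]
    (hF : IsCaratheodory F) (hG : GrowthAbs F p l) (hl : ∀ i, 0 ≤ l i ∧ l i + p ≤ q) :
    NemytskiiContinuousOn F (univ : Set (Fin m → LpInter N p q)) := by
  have hp0 : 0 < p := one_pos.trans hp.out
  have hq0 : 0 < q := one_pos.trans hq.out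
  obtain ⟨K, hK, hb⟩ := hG.exists_ae_abs_nemytskii_le (N := N) hp.out.le
  -- The factor `2` absorbs the second copy of `|u|^p` produced by `|u|^(l+p) ≤ |u|^p + |u|^q`.
  set g : (Fin m → LpInter N p q) → Euc N → ℝ := fun U x =>
    2 * K * ∑ i, (|LpInter.rep (U i) x| ^ p + |LpInter.rep (U i) x| ^ q) with hg
  have hgpos : ∀ U x, 0 ≤ g U x := fun U x =>
    mul_nonneg (by positivity) (Finset.sum_nonneg fun i _ => by positivity)
  have hgi : ∀ U, Integrable (g U) volume := fun U =>
    (integrable_finsetSum _ fun i _ => (LpInter.integrable_and_integral (U i)).1).const_mul _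
  have hgI : ∀ U, ∫ x, g U x = 2 * K * ∑ i, (‖(U i).1.1‖ ^ p + ‖(U i).1.2‖ ^ q) := by
    intro U
    rw [hg, integral_const_mul, integral_finsetSum _ fun i _ => (LpInter.integrable_and_integral (U i)).1]
    congr 1
    exact Finset.sum_congr rfl fun i _ => (LpInter.integrable_and_integral (U i)).2
  have hbound : ∀ U : Fin m → LpInter N p q, ∀ᵐ x : Euc N,
      |nemytskii F (fun i => LpInter.rep (U i)) x| ≤ g U x := by
    intro U
    filter_upwards [hb] with x hx
    refine (hx _).trans ?_
    simp only [hg]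
    rw [mul_comm 2 K, mul_assoc]
    refine mul_le_mul_of_nonneg_left ?_ hK
    rw [Finset.mul_sum]
    refine Finset.sum_le_sum fun i _ => ?_
    have h1 := rpow_le_rpow_add_rpow (abs_nonneg (LpInter.rep (U i) x)) hp0
      (by linarith [(hl i).1] : p ≤ l i + p) (hl i).2
    have h2 : 0 ≤ |LpInter.rep (U i) x| ^ q := by positivity
    linarith
  have haesm : ∀ U : Fin m → LpInter N p q,
      AEStronglyMeasurable (nemytskii F fun i => LpInter.rep (U i)) volume := fun U =>
    hF.aestronglyMeasurable_nemytskii fun i => LpInter.rep_aesm (U i)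
  have hmem : ∀ U : Fin m → LpInter N p q,
      MemLp (nemytskii F fun i => LpInter.rep (U i)) 1 volume := fun U =>
    memLp_one_iff_integrable.2 ((hgi U).mono' (haesm U) (hbound U))
  refine ⟨fun U => hmem U.1, ?_⟩
  rw [continuous_iff_seqContinuous]
  intro U U₀ hU
  -- Almost everywhere convergence holds only after extraction, so it is enough that every
  -- subsequence has a further subsequence with the right limit.
  refine tendsto_of_subseq_tendsto fun ns hns => ?_
  have hconv : Tendsto (fun k => (U (ns k)).1) atTop (𝓝 U₀.1) :=
    (continuous_subtype_val.tendsto _).comp (hU.comp hns)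
  have hi : ∀ i, Tendsto (fun k => ((U (ns k)).1 i).1) atTop (𝓝 (U₀.1 i).1) := fun i =>
    (continuous_subtype_val.tendsto _).comp ((tendsto_pi_nhds.1 hconv) i)
  have h1 : ∀ i, Tendsto (fun k => ((U (ns k)).1 i).1.1) atTop (𝓝 (U₀.1 i).1.1) := fun i =>
    (continuous_fst.tendsto _).comp (hi i)
  have h2 : ∀ i, Tendsto (fun k => ((U (ns k)).1 i).1.2) atTop (𝓝 (U₀.1 i).1.2) := fun i =>
    (continuous_snd.tendsto _).comp (hi i)
  obtain ⟨φ, hφ, hae⟩ := exists_subseq_tendsto_ae h1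
  refine ⟨φ, ?_⟩
  refine (Lp.tendsto_Lp_iff_tendsto_eLpNorm''
    (fun k => nemytskii F fun i => LpInter.rep ((U (ns (φ k))).1 i))
    (fun k => hmem (U (ns (φ k))).1) (nemytskii F fun i => LpInter.rep (U₀.1 i))
    (hmem U₀.1)).2 ?_
  refine tendsto_eLpNorm_one_of_tendsto_dominating (g := fun k => g (U (ns (φ k))).1)
    (g₀ := g U₀.1) (fun k => haesm _) (fun k => hgi _) (hgi _) (fun k => hbound _)
    (fun k x => hgpos _ _) ?_ ?_ ?_
  · filter_upwards [hae, hF.ae_continuous (N := N)] with x hx hc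
    exact tendsto_nemytskii hc hx
  · filter_upwards [hae] with x hx
    refine Tendsto.const_mul _ (tendsto_finsetSum _ fun i _ => ?_)
    exact ((hx i).abs.rpow_const (Or.inr hp0.le)).add ((hx i).abs.rpow_const (Or.inr hq0.le))
  · simp only [hgI]
    refine Tendsto.const_mul _ (tendsto_finsetSum _ fun i _ => ?_)
    exact ((((h1 i).comp hφ.tendsto_atTop).norm).rpow_const (Or.inr hp0.le)).add
      ((((h2 i).comp hφ.tendsto_atTop).norm).rpow_const (Or.inr hq0.le))

end Growth

/-! ### Reduction of the nonnegative case by componentwise absolute values -/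

section PositivePart

variable {N m : ℕ} {F : ℝ → Euc m → ℝ} {p q : ℝ} {l : Fin m → ℝ}

/-- The componentwise absolute value. -/
noncomputable def absVec (s : Euc m) : Euc m := WithLp.toLp 2 fun i => |s i|

theorem norm_absVec (s : Euc m) : ‖absVec s‖ = ‖s‖ := by
  simp [EuclideanSpace.norm_eq, absVec]

theorem continuous_absVec : Continuous (absVec : Euc m → Euc m) := by
  unfold absVec
  fun_prop

theorem IsCaratheodory.comp_absVec (hF : IsCaratheodory F) :
    IsCaratheodory fun r s => F r (absVec s) := by
  obtain ⟨Γ, h0, hm, hc⟩ := hF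
  exact ⟨Γ, h0, fun s => hm _, fun r hr => (hc r hr).comp continuous_absVec⟩

theorem GrowthNonneg.comp_absVec (hF : GrowthNonneg F p l) :
    GrowthAbs (fun r s => F r (absVec s)) p l := by
  obtain ⟨K, hK, h⟩ := hF
  refine ⟨K, hK, ?_⟩
  filter_upwards [h] with r hr s
  obtain ⟨h1, h2⟩ := hr (absVec s) fun i => abs_nonneg _
  rw [abs_of_nonneg h1, ← norm_absVec s]
  exact h2

/-- The decay condition bounds `F` only from above; the lower bound `0 ≤ F` needed for the absolute
value comes from the growth condition. -/
theorem DecayNonneg.comp_absVec (hF : DecayNonneg F p) (hG : GrowthNonneg F p l) :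
    DecayAbs (fun r s => F r (absVec s)) p := by
  intro ε hε
  obtain ⟨R, s₀, hR, hs, h⟩ := hF ε hε
  obtain ⟨K, -, hK⟩ := hG
  refine ⟨R, s₀, hR, hs, ?_⟩
  filter_upwards [h, ae_restrict_of_ae_restrict_of_subset (Ici_subset_Ici.2 hR.le) hK]
    with r hr hr' s hss
  rw [abs_of_nonneg (hr' (absVec s) fun i => abs_nonneg _).1, ← norm_absVec s]
  exact hr (absVec s) fun i => ⟨abs_nonneg _, hss i⟩

theorem nemytskii_comp_absVec_ae_eq {U : Fin m → Euc N → ℝ}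
    (hU : ∀ i, 0 ≤ᵐ[volume] U i) :
    nemytskii (fun r s => F r (absVec s)) U =ᵐ[volume] nemytskii F U := by
  filter_upwards [ae_all_iff.2 hU] with x hx
  simp only [nemytskii, absVec]
  congr 2
  funext i
  exact abs_of_nonneg (hx i)

theorem NemytskiiContinuousOn.congr_subset {F' : ℝ → Euc m → ℝ} [Fact (1 < p)] [Fact (1 < q)]
    {A B : Set (Fin m → LpInter N p q)} (hF : NemytskiiContinuousOn F' B) (hAB : A ⊆ B)
    (h : ∀ U ∈ A, nemytskii F' (fun i => LpInter.rep (U i)) =ᵐ[volume]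
      nemytskii F fun i => LpInter.rep (U i)) : NemytskiiContinuousOn F A := by
  obtain ⟨hm, hc⟩ := hF
  refine ⟨fun U => (hm ⟨U.1, hAB U.2⟩).ae_eq (h U.1 U.2), ?_⟩
  refine (hc.comp (continuous_inclusion hAB)).congr fun U => ?_
  exact MemLp.toLp_congr (hm ⟨U.1, hAB U.2⟩) _ (h U.1 U.2)

theorem NemytskiiCompactOn.congr_subset {F' : ℝ → Euc m → ℝ} [Fact (1 < p)]
    {A B : Set (Fin m → SobolevW1 N p)} (hF : NemytskiiCompactOn F' B) (hAB : A ⊆ B)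
    (h : ∀ U ∈ A, nemytskii F' (fun i => SobolevW1.rep (U i)) =ᵐ[volume]
      nemytskii F fun i => SobolevW1.rep (U i)) : NemytskiiCompactOn F A := by
  obtain ⟨hm, hc⟩ := hF
  refine ⟨fun U => (hm ⟨U.1, hAB U.2⟩).ae_eq (h U.1 U.2), fun S hS => ?_⟩
  have hb : Bornology.IsBounded (inclusion hAB '' S) := by
    obtain ⟨C, hC⟩ := Metric.isBounded_iff.1 hS
    refine Metric.isBounded_iff.2 ⟨C, ?_⟩
    rintro _ ⟨x, hx, rfl⟩ _ ⟨y, hy, rfl⟩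
    exact hC hx hy
  have := hc _ hb
  rw [image_image] at this
  convert this using 2
  refine image_congr fun U _ => ?_
  exact (MemLp.toLp_congr (hm ⟨U.1, hAB U.2⟩) _ (h U.1 U.2)).symm

end PositivePart

/-! ### Asymptotics of the radial weight and the exponent at the origin -/

section Weight

open Filter Topology

variable {N : ℕ} {p : ℝ}

/-- The integrand is nonincreasing, hence largest at the left endpoint. -/
theorem radialWeight_le (hp : 1 < p) (hN : 1 ≤ N) {r s : ℝ} (hr : 0 < r) (hrs : r ≤ s) :
    radialWeight N p r s ≤ (s - r) * r ^ (-((N - 1 : ℝ) / (p - 1))) := by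
  have hN' : (1 : ℝ) ≤ N := by exact_mod_cast hN
  have hb : 0 ≤ (N - 1 : ℝ) / (p - 1) := div_nonneg (by linarith) (by linarith)
  have hcont : ContinuousOn (fun t : ℝ => t ^ (-((N - 1 : ℝ) / (p - 1)))) (uIcc r s) := by
    rw [uIcc_of_le hrs]
    exact fun t ht =>
      (Real.continuousAt_rpow_const _ _ (Or.inl (hr.trans_le ht.1).ne')).continuousWithinAt
  calc radialWeight N p r s ≤ ∫ _ in r..s, r ^ (-((N - 1 : ℝ) / (p - 1))) := by
        refine intervalIntegral.integral_mono_on hrs hcont.intervalIntegrable (by simp) ?_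
        intro t ht
        exact Real.rpow_le_rpow_of_nonpos hr ht.1 (by linarith)
    _ = _ := by simp

theorem radialWeight_nonneg {r s : ℝ} (hr : 0 < r) (hrs : r ≤ s) : 0 ≤ radialWeight N p r s :=
  intervalIntegral.integral_nonneg hrs fun _ ht => Real.rpow_nonneg (hr.trans_le ht.1).le _

/-- Behaviour of the weight near the origin. -/
theorem exists_radialWeight_le_rpow (hp : 1 < p) {a R : ℝ} (ha : 0 < a) (hR : 0 < R)
    (hNa : (N - p) / p ≤ a) :
    ∃ C : ℝ, 0 ≤ C ∧ ∀ r, 0 < r → r < R →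
      radialWeight N p r (r + 1) ^ (1 / p.conjExponent) ≤ C * r ^ (-a) := by
  have hq : p.HolderConjugate p.conjExponent := Real.HolderConjugate.conjExponent hp
  have hp1 : 0 < p - 1 := by linarith
  have hp0 : 0 < p := by linarith
  set q := p.conjExponent with hqdef
  have hq0 : 0 < q := hq.symm.pos
  set b : ℝ := (N - 1 : ℝ) / (p - 1) with hb
  -- This restates `(N - p)/p ≤ a`. It makes the exponent in `t^(-b) = t^(1+aq-b) t^(-(1+aq))`
  -- nonnegative, so the first factor is at most a power of `R + 1` and the second integrates to a
  -- multiple of `r^(-aq)`.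
  have hbq : b ≤ 1 + a * q := by
    rw [hb, hqdef, Real.conjExponent, div_le_iff₀ hp1]
    rw [div_le_iff₀ hp0] at hNa
    field_simp
    linarith
  have haq : 0 < a * q := mul_pos ha hq0
  refine ⟨(((R + 1) ^ (1 + a * q - b)) / (a * q)) ^ (1 / q), ?_, fun r hr hrR => ?_⟩
  · positivity
  have h1 : radialWeight N p r (r + 1) ≤ ((R + 1) ^ (1 + a * q - b)) / (a * q) * r ^ (-(a * q)) := by
    have hc : ∀ e : ℝ, ContinuousOn (fun t : ℝ => t ^ e) (uIcc r (r + 1)) := by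
      intro e
      rw [uIcc_of_le (by linarith)]
      exact fun t ht =>
        (Real.continuousAt_rpow_const _ _ (Or.inl (hr.trans_le ht.1).ne')).continuousWithinAt
    calc radialWeight N p r (r + 1)
        ≤ ∫ t in r..(r + 1), (R + 1) ^ (1 + a * q - b) * t ^ (-(1 + a * q)) := by
          refine intervalIntegral.integral_mono_on (by linarith) (hc _).intervalIntegrable
            ((hc _).intervalIntegrable.const_mul _) ?_
          intro t ht
          have ht0 : 0 < t := hr.trans_le ht.1
          have : t ^ (-b) = t ^ (1 + a * q - b) * t ^ (-(1 + a * q)) := by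
            rw [← Real.rpow_add ht0]
            congr 1
            ring
          rw [this]
          exact mul_le_mul_of_nonneg_right
            (Real.rpow_le_rpow ht0.le (by linarith [ht.2]) (by linarith)) (by positivity)
      _ = (R + 1) ^ (1 + a * q - b) * ((r ^ (-(a * q)) - (r + 1) ^ (-(a * q))) / (a * q)) := by
          rw [intervalIntegral.integral_const_mul, integral_rpow]
          · congr 1
            rw [show -(1 + a * q) + 1 = -(a * q) by ring]
            field_simp
            ring
          · right
            refine ⟨by linarith, ?_⟩
            rw [uIcc_of_le (by linarith)]
            exact fun h => absurd h.1 (not_le.2 hr)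
      _ ≤ (R + 1) ^ (1 + a * q - b) * (r ^ (-(a * q)) / (a * q)) := by
          gcongr
          have : 0 ≤ (r + 1) ^ (-(a * q)) := by positivity
          linarith
      _ = _ := by ring
  calc radialWeight N p r (r + 1) ^ (1 / q)
      ≤ (((R + 1) ^ (1 + a * q - b)) / (a * q) * r ^ (-(a * q))) ^ (1 / q) :=
        Real.rpow_le_rpow (radialWeight_nonneg hr (by linarith)) h1 (by positivity)
    _ = _ := by
        rw [Real.mul_rpow (by positivity) (by positivity), ← Real.rpow_mul hr.le]
        congr 2
        field_simp

/-- The weight decays at infinity. -/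
theorem tendsto_radialWeight (hp : 1 < p) (hN : 2 ≤ N) :
    Tendsto (fun r => radialWeight N p r (r + 1) ^ (1 / p.conjExponent)) atTop (𝓝 0) := by
  have hq : p.HolderConjugate p.conjExponent := Real.HolderConjugate.conjExponent hp
  have hq0 : 0 < p.conjExponent := hq.symm.pos
  have hN' : (2 : ℝ) ≤ N := by exact_mod_cast hN
  have hb : 0 < (N - 1 : ℝ) / (p - 1) := div_pos (by linarith) (by linarith)
  have h1 : Tendsto (fun r : ℝ => (r ^ (-((N - 1 : ℝ) / (p - 1)))) ^ (1 / p.conjExponent)) atTop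
      (𝓝 0) := by
    have := (tendsto_rpow_neg_atTop hb).rpow_const (p := 1 / p.conjExponent)
      (Or.inr (by positivity))
    rwa [Real.zero_rpow (by positivity)] at this
  refine tendsto_of_tendsto_of_tendsto_of_le_of_le' tendsto_const_nhds h1 ?_ ?_
  · filter_upwards [eventually_gt_atTop 0] with r hr
    exact Real.rpow_nonneg (radialWeight_nonneg hr (by linarith)) _
  · filter_upwards [eventually_gt_atTop 0] with r hr
    refine Real.rpow_le_rpow (radialWeight_nonneg hr (by linarith)) ?_ (by positivity)
    simpa using radialWeight_le hp (by linarith) hr (by linarith : r ≤ r + 1)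

/-- The modulus of continuity given by the weight is locally uniform on `(0, ∞)`. -/
theorem exists_delta_radialWeight (hp : 1 < p) (hN : 1 ≤ N) (A : ℝ) {r ε : ℝ} (hr : 0 < r)
    (hε : 0 < ε) (hA : 0 ≤ A) : ∃ δ : ℝ, 0 < δ ∧ ∀ s, 0 < s → |s - r| < δ →
      A * radialWeight N p (min r s) (max r s) ^ (1 / p.conjExponent) ≤ ε := by
  have hq : p.HolderConjugate p.conjExponent := Real.HolderConjugate.conjExponent hp
  have hq0 : 0 < p.conjExponent := hq.symm.pos
  have hN' : (1 : ℝ) ≤ N := by exact_mod_cast hN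
  have hb : 0 ≤ (N - 1 : ℝ) / (p - 1) := div_nonneg (by linarith) (by linarith)
  -- Points within `r/2` of `r` stay above `r/2`, where the integrand is at most `c`.
  set c : ℝ := (r / 2) ^ (-((N - 1 : ℝ) / (p - 1))) with hc
  have h1 : Tendsto (fun δ : ℝ => A * (δ * c) ^ (1 / p.conjExponent)) (𝓝 0) (𝓝 0) := by
    have h2 : Continuous fun δ : ℝ => A * (δ * c) ^ (1 / p.conjExponent) :=
      continuous_const.mul ((continuous_id.mul continuous_const).rpow_const
        fun _ => Or.inr (by positivity))
    have := h2.tendsto 0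
    rwa [zero_mul, Real.zero_rpow (by positivity), mul_zero] at this
  obtain ⟨δ, hδ, h⟩ := Metric.eventually_nhds_iff.1 (h1.eventually (gt_mem_nhds hε))
  refine ⟨min δ (r / 2), by positivity, fun s hs hsr => ?_⟩
  have hsr2 : |s - r| < r / 2 := hsr.trans_le (min_le_right _ _)
  have hmin : r / 2 ≤ min r s := by
    rw [abs_lt] at hsr2
    exact le_min (by linarith) (by linarith)
  have hmm : 0 < min r s := lt_min hr hs
  have h3 : radialWeight N p (min r s) (max r s) ≤ |s - r| * c := by
    refine (radialWeight_le hp hN hmm min_le_max).trans ?_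
    rw [max_sub_min_eq_abs]
    exact mul_le_mul_of_nonneg_left (Real.rpow_le_rpow_of_nonpos (by positivity) hmin (by linarith))
      (abs_nonneg _)
  have h4 := h (y := |s - r|) (by
    rw [Real.dist_eq, sub_zero, abs_abs]
    exact hsr.trans_le (min_le_left _ _))
  refine le_trans ?_ h4.le
  exact mul_le_mul_of_nonneg_left (Real.rpow_le_rpow (radialWeight_nonneg hmm min_le_max) h3
    (by positivity)) hA

/-- An exponent for the singularity at the origin that is admissible for all subcritical powers. -/
theorem exists_singular_exponent (hp : 1 < p) (hN : 1 ≤ N) :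
    ∃ a : ℝ, 0 < a ∧ (N - p) / p ≤ a ∧ ∀ t, t < p + p ^ 2 / N → a * t < N := by
  have hN' : (0 : ℝ) < N := by exact_mod_cast hN
  have hp0 : 0 < p := by linarith
  -- For `p < N` the natural exponent works, with `p²/N` to spare at the critical power. Otherwise
  -- `(N - p)/p ≤ 0`, and `a` is any small positive number, chosen so that the critical power gives
  -- `N/2`.
  rcases lt_or_ge p N with h | h
  · have ha : 0 < (N - p) / p := div_pos (by linarith) hp0
    refine ⟨(N - p) / p, ha, le_rfl, fun t ht => ?_⟩
    calc (N - p) / p * t < (N - p) / p * (p + p ^ 2 / N) := mul_lt_mul_of_pos_left ht ha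
      _ = N - p ^ 2 / N := by field_simp; ring
      _ ≤ N := sub_le_self _ (by positivity)
  · have hs : 0 < p + p ^ 2 / N := by positivity
    refine ⟨N / (2 * (p + p ^ 2 / N)), by positivity, ?_, fun t ht => ?_⟩
    · exact (div_nonpos_of_nonpos_of_nonneg (by linarith) hp0.le).trans (by positivity)
    · calc N / (2 * (p + p ^ 2 / N)) * t < N / (2 * (p + p ^ 2 / N)) * (p + p ^ 2 / N) :=
            mul_lt_mul_of_pos_left ht (by positivity)
        _ = N / 2 := by field_simp
        _ < N := by linarith

theorem integrableOn_ball_norm_rpow [Nontrivial (Euc N)] {e R : ℝ} (he : e < N) :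
    IntegrableOn (fun x : Euc N => ‖x‖ ^ (-e)) (Metric.ball 0 R) := by
  rcases le_or_gt R 0 with hR | hR
  · simp [Metric.ball_eq_empty.2 hR]
  rw [integrableOn_fun_norm_addHaar (volume : Measure (Euc N)) (f := fun t => t ^ (-e)),
    finrank_euclideanSpace_fin]
  have h1 : IntegrableOn (fun t : ℝ => t ^ ((N : ℝ) - 1 - e)) (Ioo 0 R) :=
    (intervalIntegral.integrableOn_Ioo_rpow_iff hR).2 (by linarith)
  refine h1.congr_fun (fun t ht => ?_) measurableSet_Ioo
  simp only [smul_eq_mul]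
  rw [← Real.rpow_natCast, ← Real.rpow_add ht.1, cast_sub_one_of_nontrivial]
  congr 1

end Weight

/-! ### Pointwise convergent subsequences -/

section Extraction

open Filter Topology

/-- A pointwise bounded, pointwise equicontinuous sequence of tuples of functions on `(0, ∞)` has
a pointwise convergent subsequence. -/
theorem exists_subseq_tendsto_of_equicontinuous {ι : Type*} [Countable ι] {f : ℕ → ι → ℝ → ℝ}
    {B : ℝ → ℝ} (hB : ∀ k i r, 0 < r → |f k i r| ≤ B r)
    (he : ∀ r ε : ℝ, 0 < r → 0 < ε → ∃ δ : ℝ, 0 < δ ∧ ∀ s, 0 < s → |s - r| < δ →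
      ∀ k i, |f k i s - f k i r| ≤ ε) :
    ∃ φ : ℕ → ℕ, StrictMono φ ∧ ∃ g : ι → ℝ → ℝ, ∀ i r, 0 < r →
      Tendsto (fun k => f (φ k) i r) atTop (𝓝 (g i r)) := by
  let Y := ι × {q : ℚ // 0 < q}
  -- Values at positive rational radii lie in a countable product of compact intervals, whose
  -- sequential compactness replaces a diagonal argument.
  let K : Set (Y → ℝ) := pi univ fun z => Icc (-B (z.2.1 : ℝ)) (B (z.2.1 : ℝ))
  have hK : IsCompact K := isCompact_univ_pi fun z => isCompact_Icc
  have hmem : ∀ k, (fun z : Y => f k z.1 (z.2.1 : ℝ)) ∈ K := fun k z _ =>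
    abs_le.1 (hB k z.1 _ (by exact_mod_cast z.2.2))
  obtain ⟨L, -, φ, hφ, hL⟩ := hK.tendsto_subseq hmem
  have hrat : ∀ i (q : ℚ), 0 < q → CauchySeq fun k => f (φ k) i q := fun i q hq =>
    ((tendsto_pi_nhds.1 hL) (i, ⟨q, hq⟩)).cauchySeq
  have hcau : ∀ i r, 0 < r → CauchySeq fun k => f (φ k) i r := by
    intro i r hr
    rw [Metric.cauchySeq_iff]
    intro ε hε
    -- Three quarters suffice: two for moving between `r` and a nearby rational, one for the Cauchy
    -- property at that rational.
    obtain ⟨δ, hδ, h⟩ := he r (ε / 4) hr (by positivity)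
    obtain ⟨q, hq1, hq2⟩ := exists_rat_btwn (show r < r + δ by linarith)
    have hq0 : (0 : ℝ) < q := hr.trans hq1
    obtain ⟨n, hn⟩ := Metric.cauchySeq_iff.1 (hrat i q (by exact_mod_cast hq0)) (ε / 4)
      (by positivity)
    refine ⟨n, fun j hj k hk => ?_⟩
    have h1 := hn j hj k hk
    have h2 : |(q : ℝ) - r| < δ := by
      rw [abs_of_pos (by linarith)]
      linarith
    have h3 := h q hq0 h2 (φ j) i
    have h4 := h q hq0 h2 (φ k) i
    rw [Real.dist_eq] at h1 ⊢
    rw [abs_lt] at h1 ⊢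
    rw [abs_le] at h3 h4
    constructor <;> linarith [h1.1, h1.2, h3.1, h3.2, h4.1, h4.2]
  have hlim : ∀ i r, ∃ a, 0 < r → Tendsto (fun k => f (φ k) i r) atTop (𝓝 a) := by
    intro i r
    by_cases hr : 0 < r
    · obtain ⟨a, ha⟩ := cauchySeq_tendsto_of_complete (hcau i r hr)
      exact ⟨a, fun _ => ha⟩
    · exact ⟨0, fun h => absurd h hr⟩
  choose g hg using hlim
  exact ⟨φ, hφ, g, hg⟩

end Extraction

/-! ### Compactness on radial Sobolev tuples -/

section Compactness

open Filter Topology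

variable {N m : ℕ} {F : ℝ → Euc m → ℝ} {p : ℝ} {l : Fin m → ℝ}

theorem SobolevW1.rep_aesm [Fact (1 < p)] (u : SobolevW1 N p) :
    AEStronglyMeasurable (SobolevW1.rep u) volume := Lp.aestronglyMeasurable _

theorem SobolevW1.integrable_and_integral_le [hp : Fact (1 < p)] (u : SobolevW1 N p) :
    Integrable (fun x => |SobolevW1.rep u x| ^ p) volume ∧
      ∫ x, |SobolevW1.rep u x| ^ p ≤ ‖u‖ ^ p := by
  have hp0 : 0 < p := one_pos.trans hp.out
  refine ⟨MemLp.integrable_abs_rpow hp0 (Lp.memLp u.1.1), ?_⟩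
  exact (integral_abs_rpow_eq_norm_rpow hp0 u.1.1).trans_le
    (Real.rpow_le_rpow (norm_nonneg _) (norm_fst_le u.1) hp0.le)

/-- Pointwise bounds for radial Sobolev functions, uniform on bounded sets: a power bound on
balls and decay at infinity. -/
theorem exists_radial_bound [Nontrivial (Euc N)] [hp : Fact (1 < p)] (hN : 2 ≤ N) {a : ℝ}
    (ha : 0 < a) (hNa : (N - p) / p ≤ a) {M : ℝ} (hM : 0 ≤ M) :
    ∃ W : ℝ → ℝ, (∀ u : SobolevW1 N p, IsRadial (SobolevW1.rep u) → ‖u‖ ≤ M →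
        ∀ᵐ x : Euc N, |SobolevW1.rep u x| ≤ W ‖x‖) ∧
      (∀ R, 0 < R → ∃ C, 0 ≤ C ∧ ∀ r, 0 < r → r < R → W r ≤ C * r ^ (-a)) ∧
      Tendsto W atTop (𝓝 0) := by
  obtain ⟨D, hD, h⟩ := exists_radial_representative (N := N) (p := p)
  have hJ : ∀ r, 0 < r → 0 ≤ radialWeight N p r (r + 1) ^ (1 / p.conjExponent) := fun r hr =>
    Real.rpow_nonneg (radialWeight_nonneg hr (by linarith)) _
  refine ⟨fun r => D * M * radialWeight N p r (r + 1) ^ (1 / p.conjExponent), ?_, ?_, ?_⟩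
  · intro u hu huM
    obtain ⟨f, hf, hf1, -⟩ := h u hu
    have hne : ∀ᵐ x : Euc N, x ≠ 0 := by simp [ae_iff]
    filter_upwards [hf, hne] with x hx hx0
    have hx1 : 0 < ‖x‖ := norm_pos_iff.2 hx0
    rw [hx]
    exact (hf1 _ hx1).trans (mul_le_mul_of_nonneg_right (mul_le_mul_of_nonneg_left huM hD)
      (hJ _ hx1))
  · intro R hR
    obtain ⟨C, hC, hCr⟩ := exists_radialWeight_le_rpow (N := N) hp.out ha hR hNa
    refine ⟨D * M * C, by positivity, fun r hr hrR => ?_⟩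
    rw [mul_assoc]
    exact mul_le_mul_of_nonneg_left (hCr r hr hrR) (by positivity)
  · have := (tendsto_radialWeight (N := N) hp.out hN).const_mul (D * M)
    rwa [mul_zero] at this

/-- The tail estimate: `|U|^p` has an integral bounded in terms of `M`, so a small factor `c` makes
the integral small uniformly on bounded sets. -/
theorem lintegral_enorm_le_of_abs_le_norm_rpow [hp : Fact (1 < p)] {U : Fin m → SobolevW1 N p}
    {M : ℝ} (hU : ∀ i, ‖U i‖ ≤ M) {c : ℝ} (hc : 0 ≤ c) {S : Set (Euc N)}
    {f : Euc N → ℝ} (hf : ∀ᵐ x ∂(volume.restrict S),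
      |f x| ≤ c * ‖(WithLp.toLp 2 fun i => SobolevW1.rep (U i) x : Euc m)‖ ^ p) :
    ∫⁻ x in S, ‖f x‖ₑ ≤ ENNReal.ofReal (c * ((m : ℝ) ^ (p - 1) * (m * M ^ p))) := by
  have hp0 : 0 < p := one_pos.trans hp.out
  have hA0 : (0 : ℝ) ≤ (m : ℝ) ^ (p - 1) := by positivity
  have hi : ∀ i ∈ (Finset.univ : Finset (Fin m)),
      Integrable (fun x => |SobolevW1.rep (U i) x| ^ p) volume := fun i _ =>
    (SobolevW1.integrable_and_integral_le (U i)).1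
  have hHi : Integrable (fun x => c * ((m : ℝ) ^ (p - 1) * ∑ i, |SobolevW1.rep (U i) x| ^ p))
      volume := ((integrable_finsetSum _ hi).const_mul _).const_mul c
  have hH0 : ∀ x, 0 ≤ c * ((m : ℝ) ^ (p - 1) * ∑ i, |SobolevW1.rep (U i) x| ^ p) := fun x =>
    mul_nonneg hc (mul_nonneg hA0 (Finset.sum_nonneg fun i _ => by positivity))
  have hint : ∫ x, c * ((m : ℝ) ^ (p - 1) * ∑ i, |SobolevW1.rep (U i) x| ^ p) ≤
      c * ((m : ℝ) ^ (p - 1) * (m * M ^ p)) := by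
    rw [integral_const_mul, integral_const_mul, integral_finsetSum _ hi]
    refine mul_le_mul_of_nonneg_left (mul_le_mul_of_nonneg_left ?_ hA0) hc
    refine (Finset.sum_le_card_nsmul _ _ (M ^ p) fun i _ => ?_).trans (by simp)
    exact (SobolevW1.integrable_and_integral_le (U i)).2.trans
      (Real.rpow_le_rpow (norm_nonneg _) (hU i) hp0.le)
  have hb : ∀ᵐ x ∂(volume.restrict S), ‖f x‖ₑ ≤
      ENNReal.ofReal (c * ((m : ℝ) ^ (p - 1) * ∑ i, |SobolevW1.rep (U i) x| ^ p)) := by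
    filter_upwards [hf] with x hx
    rw [← ofReal_norm, Real.norm_eq_abs]
    exact ENNReal.ofReal_le_ofReal
      (hx.trans (mul_le_mul_of_nonneg_left (norm_euc_rpow_le hp.out.le _) hc))
  refine (lintegral_mono_ae hb).trans ((setLIntegral_le_lintegral _ _).trans ?_)
  rw [← ofReal_integral_eq_lintegral_ofReal hHi (ae_of_all _ hH0)]
  exact ENNReal.ofReal_le_ofReal hint

/-- On bounded sets of radial Sobolev tuples the superposition is dominated by an integrable
function on a large ball, with uniformly small integral outside. -/
theorem exists_dominated_nemytskii [Nontrivial (Euc N)] [hp : Fact (1 < p)] (hN : 2 ≤ N)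
    (hl : ∀ i, 0 ≤ l i ∧ l i < p ^ 2 / N) (hG : GrowthAbs F p l) (hD : DecayAbs F p)
    {M : ℝ} (hM : 0 ≤ M) {ε : ℝ} (hε : 0 < ε) :
    ∃ S : Set (Euc N), MeasurableSet S ∧ ∃ G : Euc N → ℝ, IntegrableOn G S volume ∧
      ∀ U ∈ radialTuples N m p, (∀ i, ‖U i‖ ≤ M) →
        (∀ᵐ x ∂(volume.restrict S), |nemytskii F (fun i => SobolevW1.rep (U i)) x| ≤ G x) ∧
        ∫⁻ x in Sᶜ, ‖nemytskii F (fun i => SobolevW1.rep (U i)) x‖ₑ ≤ ENNReal.ofReal ε := by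
  have hp1 : 1 < p := hp.out
  have hp0 : 0 < p := one_pos.trans hp1
  have hN0 : (0 : ℝ) < N := by
    have : (2 : ℝ) ≤ N := by exact_mod_cast hN
    linarith
  obtain ⟨a, ha, hNa, hat⟩ := exists_singular_exponent (N := N) hp1 (by linarith)
  obtain ⟨W, hW, hW0, hWi⟩ := exists_radial_bound (N := N) (p := p) hN ha hNa hM
  obtain ⟨K, hK, hKb⟩ := hG.exists_ae_abs_nemytskii_le (N := N) hp1.le
  set A : ℝ := (m : ℝ) ^ (p - 1) with hA
  have hA0 : 0 ≤ A := by positivity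
  -- The denominator is the bound for the integral of `|U|^p`, plus one so that it is positive even
  -- when `m` or `M` is zero.
  set ε' : ℝ := ε / (A * (m * M ^ p) + 1) with hε'
  have hden : 0 < A * (m * M ^ p) + 1 := by positivity
  have hε'0 : 0 < ε' := by positivity
  obtain ⟨R₀, s₀, hR₀, hs₀, hdec⟩ := hD ε' hε'0
  obtain ⟨R₁, hR₁⟩ := eventually_atTop.1 (hWi.eventually (gt_mem_nhds hs₀))
  -- Beyond `R₀` the decay condition holds for small arguments, and beyond `R₁` every component is
  -- below `s₀`.
  set R : ℝ := max R₀ R₁ with hR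
  have hRpos : 0 < R := hR₀.trans_le (le_max_left _ _)
  obtain ⟨C, hC, hCW⟩ := hW0 R hRpos
  have hdec' : ∀ᵐ x : Euc N, R₀ ≤ ‖x‖ → ∀ s : Euc m, (∀ i, |s i| < s₀) →
      |F ‖x‖ s| ≤ ε' * ‖s‖ ^ p := by
    refine ae_norm_of_ae_Ici (P := fun r => R₀ ≤ r → ∀ s : Euc m, (∀ i, |s i| < s₀) →
      |F r s| ≤ ε' * ‖s‖ ^ p) ?_
    exact ae_restrict_of_ae ((ae_restrict_iff' measurableSet_Ici).1 hdec)
  refine ⟨Metric.ball 0 R, measurableSet_ball, fun x => K * ∑ i, (C ^ p * ‖x‖ ^ (-(a * p)) +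
    C ^ (l i + p) * ‖x‖ ^ (-(a * (l i + p)))), ?_, fun U hU hUM => ⟨?_, ?_⟩⟩
  · refine Integrable.const_mul (integrable_finsetSum _ fun i _ => Integrable.add ?_ ?_) _
    · exact (integrableOn_ball_norm_rpow (hat p (by
        have : 0 < p ^ 2 / (N : ℝ) := by positivity
        linarith))).const_mul _
    · exact (integrableOn_ball_norm_rpow (hat _ (by linarith [(hl i).2]))).const_mul _
  · have hne : ∀ᵐ x : Euc N, x ≠ 0 := by simp [ae_iff]
    filter_upwards [ae_restrict_of_ae hKb, ae_restrict_of_ae hne,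
      ae_restrict_of_ae (ae_all_iff.2 fun i => hW (U i) (hU i) (hUM i)),
      ae_restrict_mem measurableSet_ball] with x hx hx0 hxW hxR
    have hx1 : 0 < ‖x‖ := norm_pos_iff.2 hx0
    have hxR' : ‖x‖ < R := by simpa using hxR
    refine (hx _).trans (mul_le_mul_of_nonneg_left (Finset.sum_le_sum fun i _ => ?_) hK)
    have hpow : ∀ t, 0 ≤ t → |SobolevW1.rep (U i) x| ^ t ≤ C ^ t * ‖x‖ ^ (-(a * t)) := by
      intro t ht
      have h1 : |SobolevW1.rep (U i) x| ≤ C * ‖x‖ ^ (-a) :=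
        (hxW i).trans (hCW _ hx1 hxR')
      refine (Real.rpow_le_rpow (abs_nonneg _) h1 ht).trans (le_of_eq ?_)
      rw [Real.mul_rpow hC (by positivity), ← Real.rpow_mul hx1.le, neg_mul]
    exact add_le_add (hpow p hp0.le) (hpow _ (by linarith [(hl i).1]))
  · refine (lintegral_enorm_le_of_abs_le_norm_rpow hUM hε'0.le
      (f := nemytskii F fun i => SobolevW1.rep (U i)) ?_).trans (ENNReal.ofReal_le_ofReal ?_)
    · filter_upwards [ae_restrict_of_ae hdec',
        ae_restrict_of_ae (ae_all_iff.2 fun i => hW (U i) (hU i) (hUM i)),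
        ae_restrict_mem measurableSet_ball.compl] with x hx hxW hxR
      have hxR' : R ≤ ‖x‖ := by simpa using hxR
      exact hx ((le_max_left _ _).trans hxR') _ fun i =>
        (hxW i).trans_lt (hR₁ _ ((le_max_right _ _).trans hxR'))
    · calc ε' * (A * (m * M ^ p)) ≤ ε' * (A * (m * M ^ p) + 1) :=
            mul_le_mul_of_nonneg_left (by linarith) hε'0.le
        _ = ε := div_mul_cancel₀ _ hden.ne'

/-- Bounded sequences of tuples of radial Sobolev functions have subsequences converging almost
everywhere. -/
theorem exists_subseq_radial_tendsto_ae [Nontrivial (Euc N)] [hp : Fact (1 < p)] (hN : 1 ≤ N)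
    {M : ℝ} (hM : 0 ≤ M) {U : ℕ → Fin m → SobolevW1 N p} (hU : ∀ k, U k ∈ radialTuples N m p)
    (hUM : ∀ k i, ‖U k i‖ ≤ M) :
    ∃ φ : ℕ → ℕ, StrictMono φ ∧ ∃ V : Fin m → Euc N → ℝ, ∀ᵐ x : Euc N, ∀ i,
      Tendsto (fun k => SobolevW1.rep (U (φ k) i) x) atTop (𝓝 (V i x)) := by
  obtain ⟨D, hD, h⟩ := exists_radial_representative (N := N) (p := p)
  choose f hf hf1 hf2 using fun k i => h (U k i) (hU k i)
  have hle : ∀ k i, D * ‖U k i‖ ≤ D * M := fun k i => mul_le_mul_of_nonneg_left (hUM k i) hD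
  have hDM : 0 ≤ D * M := by positivity
  have hJ : ∀ r s, 0 < r → r ≤ s → 0 ≤ radialWeight N p r s ^ (1 / p.conjExponent) :=
    fun r s hr hrs => Real.rpow_nonneg (radialWeight_nonneg hr hrs) _
  obtain ⟨φ, hφ, g, hg⟩ := exists_subseq_tendsto_of_equicontinuous (f := f)
    (B := fun r => D * M * radialWeight N p r (r + 1) ^ (1 / p.conjExponent))
    (fun k i r hr => (hf1 k i r hr).trans
      (mul_le_mul_of_nonneg_right (hle k i) (hJ _ _ hr (by linarith))))
    (by
      intro r ε hr hε
      obtain ⟨δ, hδ, hδ'⟩ := exists_delta_radialWeight (N := N) hp.out hN (D * M) hr hε hDM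
      refine ⟨δ, hδ, fun s hs hsr k i => le_trans ?_ (hδ' s hs hsr)⟩
      have h1 : |f k i s - f k i r| = |f k i (max r s) - f k i (min r s)| := by
        rcases le_total r s with h | h
        · rw [max_eq_right h, min_eq_left h]
        · rw [max_eq_left h, min_eq_right h, abs_sub_comm]
      rw [h1]
      exact (hf2 k i _ _ (lt_min hr hs) min_le_max).trans
        (mul_le_mul_of_nonneg_right (hle k i) (hJ _ _ (lt_min hr hs) min_le_max)))
  refine ⟨φ, hφ, fun i x => g i ‖x‖, ?_⟩
  have hne : ∀ᵐ x : Euc N, x ≠ 0 := by simp [ae_iff]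
  filter_upwards [ae_all_iff.2 fun k => ae_all_iff.2 fun i => hf k i, hne] with x hx hx0 i
  simp only [hx]
  exact hg i _ (norm_pos_iff.2 hx0)

theorem nemytskiiCompactOn_radialTuples [Nontrivial (Euc N)] [hp : Fact (1 < p)] (hN : 2 ≤ N)
    (hF : IsCaratheodory F) (hl : ∀ i, 0 ≤ l i ∧ l i < p ^ 2 / N) (hG : GrowthAbs F p l)
    (hD : DecayAbs F p) : NemytskiiCompactOn F (radialTuples N m p) := by
  have haesm : ∀ U : Fin m → SobolevW1 N p,
      AEStronglyMeasurable (nemytskii F fun i => SobolevW1.rep (U i)) volume := fun U =>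
    hF.aestronglyMeasurable_nemytskii fun i => SobolevW1.rep_aesm (U i)
  have hmem : ∀ U : radialTuples N m p,
      MemLp (nemytskii F fun i => SobolevW1.rep (U.1 i)) 1 volume := by
    intro U
    -- Integrability of a single superposition is the case of a constant sequence.
    refine (memLp_and_tendsto_of_dominated_up_to (f := fun _ : ℕ => nemytskii F fun i =>
      SobolevW1.rep (U.1 i)) (fun _ => haesm U.1) (ae_of_all _ fun x => tendsto_const_nhds)
      fun ε hε => ?_).1
    obtain ⟨S, hS, G, hGS, h⟩ := exists_dominated_nemytskii hN hl hG hD (norm_nonneg U.1) hε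
    exact ⟨S, hS, G, hGS, fun _ => h U.1 U.2 fun i => norm_le_pi_norm U.1 i⟩
  refine ⟨hmem, fun B hB => isCompact_closure_of_subseq_tendsto fun y hy => ?_⟩
  choose U hUB hUy using hy
  obtain ⟨M, hM⟩ : ∃ M : ℝ, ∀ U ∈ B, ‖U.1‖ ≤ M := by
    have hB' : Bornology.IsBounded (Subtype.val '' B) := by
      obtain ⟨C, hC⟩ := Metric.isBounded_iff.1 hB
      refine Metric.isBounded_iff.2 ⟨C, ?_⟩
      rintro _ ⟨x, hx, rfl⟩ _ ⟨z, hz, rfl⟩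
      exact hC hx hz
    obtain ⟨M, hM⟩ := hB'.exists_norm_le
    exact ⟨M, fun U hU => hM _ ⟨U, hU, rfl⟩⟩
  have hM0 : 0 ≤ M := (norm_nonneg _).trans (hM _ (hUB 0))
  have hUM : ∀ k i, ‖(U k).1 i‖ ≤ M := fun k i =>
    (norm_le_pi_norm (U k).1 i).trans (hM _ (hUB k))
  obtain ⟨φ, hφ, V, hV⟩ := exists_subseq_radial_tendsto_ae (by linarith) hM0
    (U := fun k => (U k).1) (fun k => (U k).2) hUM
  -- The limit `V` is only an almost everywhere limit; its membership in the Sobolev space is not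
  -- needed, since integrability of `F(|x|,V)` comes from the domination.
  obtain ⟨h1, h2⟩ := memLp_and_tendsto_of_dominated_up_to
    (f := fun k => nemytskii F fun i => SobolevW1.rep ((U (φ k)).1 i)) (f₀ := nemytskii F V)
    (fun k => haesm _)
    (by
      filter_upwards [hV, hF.ae_continuous (N := N)] with x hx hc
      exact tendsto_nemytskii hc hx)
    (fun ε hε => by
      obtain ⟨S, hS, G, hGS, h⟩ := exists_dominated_nemytskii hN hl hG hD hM0 hε
      exact ⟨S, hS, G, hGS, fun k => h _ (U (φ k)).2 (hUM _)⟩)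
  refine ⟨h1.toLp _, φ, hφ, ?_⟩
  have h3 := (Lp.tendsto_Lp_iff_tendsto_eLpNorm''
    (fun k => nemytskii F fun i => SobolevW1.rep ((U (φ k)).1 i))
    (fun k => hmem (U (φ k))) (nemytskii F V) h1).2 h2
  refine h3.congr fun k => ?_
  exact hUy (φ k)

end Compactness

/-! ### The exponent inequality and the main theorem -/

theorem exponent_le_of_subcritical {N m : ℕ} {p q : ℝ} (hp : 1 < p)
    {l : Fin m → ℝ} (hl : ∀ i, 0 < l i ∧ l i < p ^ 2 / N)
    (hq_sub : p < N → q = p * N / (N - p))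
    (hq_super : (N : ℝ) ≤ p → p < q ∧ ∀ i, l i + p ≤ q) (i : Fin m) : l i + p ≤ q := by
  rcases lt_or_ge p N with h | h
  · have hN0 : (0 : ℝ) < N := by linarith
    have hd : 0 < (N : ℝ) - p := by linarith
    rw [hq_sub h]
    -- The critical gap `p* - p` is `p²/(N-p)`, which exceeds the admissible bound `p²/N`.
    have h1 : p * N / (N - p) = p + p ^ 2 / (N - p) := by
      field_simp
      ring
    have h2 : p ^ 2 / (N : ℝ) ≤ p ^ 2 / (N - p) :=
      div_le_div_of_nonneg_left (by positivity) hd (by linarith)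
    rw [h1]
    linarith [(hl i).2]
  · exact (hq_super h).2 i

/-- The exponent `q` plays the role of `p*`. -/
theorem proposition3p2 (N m : ℕ) (hN : 1 ≤ N) (p q : ℝ) [Fact (1 < p)] [Fact (1 < q)]
    (l : Fin m → ℝ) (hl : ∀ i, 0 < l i ∧ l i < p ^ 2 / N)
    (hq_sub : p < N → q = p * N / (N - p))
    (hq_super : (N : ℝ) ≤ p → p < q ∧ ∀ i, l i + p ≤ q)
    (F : ℝ → Euc m → ℝ) (hF : IsCaratheodory F) :
    (GrowthAbs F p l → DecayAbs F p →
      NemytskiiContinuousOn F (univ : Set (Fin m → LpInter N p q)) ∧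
      (2 ≤ N → NemytskiiCompactOn F (radialTuples N m p))) ∧
    (GrowthNonneg F p l → DecayNonneg F p →
      NemytskiiContinuousOn F
        {U : Fin m → LpInter N p q | ∀ i, 0 ≤ᵐ[volume] LpInter.rep (U i)} ∧
      (2 ≤ N → NemytskiiCompactOn F
        {U : Fin m → SobolevW1 N p | U ∈ radialTuples N m p ∧
          ∀ i, 0 ≤ᵐ[volume] SobolevW1.rep (U i)})) := by
  have : Nontrivial (Euc N) := by
    have : Nonempty (Fin N) := ⟨⟨0, hN⟩⟩
    infer_instance
  have hl' : ∀ i, 0 ≤ l i ∧ l i + p ≤ q := fun i =>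
    ⟨(hl i).1.le, exponent_le_of_subcritical Fact.out hl hq_sub hq_super i⟩
  have hl'' : ∀ i, 0 ≤ l i ∧ l i < p ^ 2 / N := fun i => ⟨(hl i).1.le, (hl i).2⟩
  refine ⟨fun hG hD => ⟨nemytskiiContinuousOn_univ hF hG hl', fun hN2 =>
    nemytskiiCompactOn_radialTuples hN2 hF hl'' hG hD⟩, fun hG hD => ⟨?_, fun hN2 => ?_⟩⟩
  · exact (nemytskiiContinuousOn_univ hF.comp_absVec hG.comp_absVec hl').congr_subset
      (subset_univ _) fun U hU => nemytskii_comp_absVec_ae_eq hU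
  · exact (nemytskiiCompactOn_radialTuples hN2 hF.comp_absVec hl'' hG.comp_absVec
      (hD.comp_absVec hG)).congr_subset (fun U hU => hU.1)
      fun U hU => nemytskii_comp_absVec_ae_eq hU.2
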